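/- Let $k$ be a field and let $A$ be a finite-dimensional elementary $k$-algebra, i.e. $A/\operatorname{rad}A$ is isomorphic as a $k$-algebra to a product of finitely many copies of $k$. Assume that $A$ has finite global dimension, and let $\{e_1,\dots,e_n\}$ be a complete set of orthogonal primitive idempotents of $A$. All dimensions are over $k$. For a finite-dimensional right $A$-module $M$ let $\underline{\dim}\,M\in\mathbb Z^n$ be the column vector with entries $\dim Me_i$; for a finite-dimensional left $A$-module $N$ let $\underline{\dim}\,N$ be the row vector with entries $\dim e_iN$; for a finite-dimensional $A$-bimodule $M$ (on which $k$ acts centrally) let $\operatorname{dm}M\in\mathbb Z^{n\times n}$ be its dimension matrix, with entries $(\operatorname{dm}M)_{ij}=\dim e_jMe_i$. Let $C_A=\operatorname{dm}A$ be the Cartan matrix, $(C_A)_{ij}=\dim\operatorname{Hom}_A(e_iA,e_jA)=\dim e_jAe_i$, and let $A^e=A^{\mathrm{op}}\otimes_kA$ be the enveloping algebra, $HH^l(A,M)=\operatorname{Ext}^l_{A^e}(A,M)$ and $HH_l(A,M)=\operatorname{Tor}_l^{A^e}(A,M)$. Then $\det C_A=\pm1$, so that $C_A^{-1}$ is an integer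 matrix, and the following four statements are equivalent and all hold; in each of them the vector spaces on the left are finite-dimensional and vanish for all large $l$, and the formula is an identity in $\mathbb Z$. 1. For all finite-dimensional right $A$-modules $M$ and $N$, $$\sum_{l\ge0}(-1)^l\dim\operatorname{Ext}_A^l(M,N)=(\underline{\dim}\,M)^T\,C_A^{-T}\,\underline{\dim}\,N .$$ 2. For every finite-dimensional right $A$-module $M$ and every finite-dimensional left $A$-module $N$, $$\sum_{l\ge0}(-1)^l\dim\operatorname{Tor}^A_l(M,N)=\underline{\dim}\,N\cdot C_A^{-1}\cdot\underline{\dim}\,M .$$ 3. For every finite-dimensional $A$-bimodule $M$, $$\sum_{l\ge0}(-1)^l\dim HH^l(A,M)=\operatorname{tr}\bigl(C_A^{-T}\cdot\operatorname{dm}M\bigr).$$ 4. For every finite-dimensional $A$-bimodule $M$, $$\sum_{l\ge0}(-1)^l\dim HH_l(A,M)=\operatorname{tr}\bigl(C_A^{-1}\cdot\operatorname{dm}M\bigr).$$ -/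

import Mathlib

open CategoryTheory MulOpposite
open scoped TensorProduct

universe u v

noncomputable section

namespace HRR

/-! ### Elementary algebras, global dimension, primitive idempotents -/

/-- `A / rad A` is isomorphic, as a `k`-algebra, to a product of finitely many copies of `k`. -/
def IsElementary (k : Type v) (A : Type u) [Field k] [Ring A] [Algebra k A] : Prop :=
  ∃ m : ℕ, Nonempty ((A ⧸ Ring.jacobson A) ≃ₐ[k] (Fin m → k))

/-- Finite (right) global dimension: the projective dimensions of all right `A`-modules are
bounded by a common natural number. Right `A`-modules are modules over `Aᵐᵒᵖ`. -/
def HasFiniteGlobalDimension (A : Type u) [Ring A] : Prop :=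
  ∃ d : ℕ, ∀ M : ModuleCat.{u} Aᵐᵒᵖ, HasProjectiveDimensionLE M d

/-- A nonzero idempotent that is not a sum of two nonzero orthogonal idempotents. -/
structure IsPrimitiveIdempotent {A : Type u} [Ring A] (e : A) : Prop where
  idem : IsIdempotentElem e
  ne_zero : e ≠ 0
  indecomposable : ∀ f g : A, IsIdempotentElem f → IsIdempotentElem g →
    f * g = 0 → g * f = 0 → e = f + g → f = 0 ∨ g = 0

/-- A complete set of orthogonal primitive idempotents `e₁, …, eₙ`. -/
structure IsCompletePrimitive {A : Type u} [Ring A] {n : ℕ} (e : Fin n → A) : Prop where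
  complete : CompleteOrthogonalIdempotents e
  primitive : ∀ i, IsPrimitiveIdempotent (e i)

/-! ### Dimension vectors and dimension matrices -/

section Dimension

variable (k : Type v) {A : Type u} [Field k] [Ring A] [Algebra k A] {n : ℕ} (e : Fin n → A)
variable (M : Type u) [AddCommGroup M] [Module k M]

/-- The dimension vector `(dim M eᵢ)ᵢ` of a right module. -/
def dimVecRight [Module Aᵐᵒᵖ M] [IsScalarTower k Aᵐᵒᵖ M] : Fin n → ℤ := fun i =>
  (Module.finrank k (LinearMap.range (Algebra.lsmul k k M (op (e i)))) : ℤ)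

/-- The dimension vector `(dim eᵢ M)ᵢ` of a left module. -/
def dimVecLeft [Module A M] [IsScalarTower k A M] : Fin n → ℤ := fun i =>
  (Module.finrank k (LinearMap.range (Algebra.lsmul k k M (e i))) : ℤ)

/-- The dimension matrix of an `A`-bimodule; its `(i, j)` entry is `dim eⱼ M eᵢ`. -/
def dimMatrix [Module A M] [Module Aᵐᵒᵖ M] [IsScalarTower k A M] [IsScalarTower k Aᵐᵒᵖ M] :
    Matrix (Fin n) (Fin n) ℤ := Matrix.of fun i j =>
  (Module.finrank k (LinearMap.range
    (Algebra.lsmul k k M (e j) ∘ₗ Algebra.lsmul k k M (op (e i)))) : ℤ)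

/-- The Cartan matrix of `A`; its `(i, j)` entry is `dim Hom_A(eᵢA, eⱼA) = dim eⱼ A eᵢ`. -/
def cartanMatrix : Matrix (Fin n) (Fin n) ℤ := dimMatrix k e A

/-- The Ringel form `⟨x, y⟩ = xᵀ C⁻ᵀ y` attached to a Cartan matrix `C`. -/
def ringelForm (C : Matrix (Fin n) (Fin n) ℤ) (x y : Fin n → ℤ) : ℤ :=
  x ⬝ᵥ Matrix.mulVec (C⁻¹).transpose y

end Dimension

/-! ### Tensor products over a noncommutative algebra and `Tor` -/

section Tor

open scoped ModuleCat

variable (k : Type v) (R : Type u) [Field k] [Ring R] [Algebra k R]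

/-- The subspace of `M ⊗[k] N` spanned by all `m r ⊗ n - m ⊗ r n`. -/
def balancedRel (M : ModuleCat.{u} Rᵐᵒᵖ) (N : ModuleCat.{u} R) : Submodule k (M ⊗[k] N) :=
  Submodule.span k {t | ∃ (m : M) (r : R) (x : N), t = (op r • m) ⊗ₜ[k] x - m ⊗ₜ[k] (r • x)}

variable {R} in
/-- A morphism `f : N ⟶ N'` induces `M ⊗_R N → M ⊗_R N'`. -/
def tensorMap (M : ModuleCat.{u} Rᵐᵒᵖ) {N N' : ModuleCat.{u} R} (f : N ⟶ N') :
    ((M ⊗[k] N) ⧸ balancedRel k R M N) →ₗ[k] ((M ⊗[k] N') ⧸ balancedRel k R M N') :=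
  Submodule.mapQ _ _ (LinearMap.lTensor M (f.hom.restrictScalars k)) (by
    rw [balancedRel, Submodule.span_le]
    rintro _ ⟨m, r, x, rfl⟩
    apply Submodule.subset_span
    exact ⟨m, r, f.hom x, by simp⟩)

/-- The functor `M ⊗_R -` from left `R`-modules to `k`-vector spaces, for a right module `M`. -/
def tensorFunctor (M : ModuleCat.{u} Rᵐᵒᵖ) : ModuleCat.{u} R ⥤ ModuleCat.{u} k where
  obj N := ModuleCat.of k ((M ⊗[k] N) ⧸ balancedRel k R M N)
  map f := ModuleCat.ofHom (tensorMap k M f)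
  map_id N := by
    ext : 2
    apply TensorProduct.ext'
    intro m x
    simp [tensorMap]
  map_comp f g := by
    ext : 2
    apply TensorProduct.ext'
    intro m x
    simp [tensorMap]

variable {R} in
theorem tensorMap_add (M : ModuleCat.{u} Rᵐᵒᵖ) {N N' : ModuleCat.{u} R} (f g : N ⟶ N') :
    tensorMap k M (f + g) = tensorMap k M f + tensorMap k M g := by
  ext : 1
  apply TensorProduct.ext'
  intro m x
  simp [tensorMap]

instance tensorFunctor_additive (M : ModuleCat.{u} Rᵐᵒᵖ) : (tensorFunctor k R M).Additive where
  map_add {N N'} f g := by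
    simp only [tensorFunctor, tensorMap_add, ModuleCat.ofHom_add]
    rfl

/-- `Tor_l^R(M, N)`: the `l`-th left derived functor of `M ⊗_R -`, evaluated at `N`. -/
def Tor (M : ModuleCat.{u} Rᵐᵒᵖ) (N : ModuleCat.{u} R) (l : ℕ) : ModuleCat.{u} k :=
  ((tensorFunctor k R M).leftDerived l).obj N

end Tor

/-! ### Bimodules and Hochschild (co)homology -/

section Hochschild

variable (k : Type v) (A : Type u) [Field k] [Ring A] [Algebra k A]

/-- The enveloping algebra `Aᵒᵖ ⊗ A`. -/
abbrev Env : Type u := Aᵐᵒᵖ ⊗[k] A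

variable (M : Type u) [AddCommGroup M] [Module k M] [Module A M] [Module Aᵐᵒᵖ M]
  [IsScalarTower k A M] [IsScalarTower k Aᵐᵒᵖ M] [SMulCommClass A Aᵐᵒᵖ M]

/-- An `A`-bimodule as a left module over its enveloping algebra: `(a ⊗ b) m = b m a`. -/
def leftEnv : ModuleCat.{u} (Env k A) :=
  letI : SMulCommClass Aᵐᵒᵖ A M := SMulCommClass.symm _ _ _
  letI : Module (Env k A) M := TensorProduct.Algebra.module
  ModuleCat.of (Env k A) M

/-- The algebra isomorphism `(Aᵒᵖ ⊗ A)ᵒᵖ ≅ A ⊗ Aᵒᵖ` that sends `a ⊗ b` to `a ⊗ b`. -/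
def envOp : (Env k A)ᵐᵒᵖ ≃ₐ[k] A ⊗[k] Aᵐᵒᵖ :=
  (Algebra.TensorProduct.opAlgEquiv k k Aᵐᵒᵖ A).symm.trans
    (Algebra.TensorProduct.congr (AlgEquiv.opOp k A).symm AlgEquiv.refl)

/-- An `A`-bimodule as a right module over its enveloping algebra: `m (a ⊗ b) = a m b`. -/
def rightEnv : ModuleCat.{u} (Env k A)ᵐᵒᵖ :=
  letI : Module (A ⊗[k] Aᵐᵒᵖ) M := TensorProduct.Algebra.module
  letI : Module (Env k A)ᵐᵒᵖ M := Module.compHom M (envOp k A).toAlgHom.toRingHom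
  ModuleCat.of (Env k A)ᵐᵒᵖ M

theorem leftEnv_smul (a b : A) (m : M) :
    ((op a ⊗ₜ[k] b : Env k A) • (show leftEnv k A M from m) : leftEnv k A M) =
      (show leftEnv k A M from b • op a • m) :=
  (smul_comm b (op a) m).symm

theorem rightEnv_smul (a b : A) (m : M) :
    (op (op a ⊗ₜ[k] b : Env k A) • (show rightEnv k A M from m) : rightEnv k A M) =
      (show rightEnv k A M from a • op b • m) :=
  rfl

/-- `HH^l(A, M) = Ext^l_{Aᵉ}(A, M)`. -/
abbrev HHCohomology (l : ℕ) : Type u :=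
  Abelian.Ext.{u} (rightEnv k A A) (rightEnv k A M) l

/-- `HH_l(A, M) = Tor_l^{Aᵉ}(A, M)`. -/
abbrev HHHomology (l : ℕ) : ModuleCat.{u} k :=
  Tor k (Env k A) (rightEnv k A A) (leftEnv k A M) l

end Hochschild

/-! ### The four Hirzebruch–Riemann–Roch type formulas -/

/-- `∑ₗ (-1)ˡ dim Vₗ = χ`, where all `Vₗ` are finite dimensional and almost all vanish. -/
structure IsEulerChar (k : Type v) [Field k] (V : ℕ → Type u) [∀ l, AddCommGroup (V l)]
    [∀ l, Module k (V l)] (χ : ℤ) : Prop where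
  finite : ∀ l, Module.Finite k (V l)
  bounded : ∃ d : ℕ, ∀ l, d < l → Subsingleton (V l)
  sum_eq : ∑ᶠ l : ℕ, (-1 : ℤ) ^ l * (Module.finrank k (V l) : ℤ) = χ

section Formulas

variable (k : Type v) {A : Type u} [Field k] [Ring A] [Algebra k A] {n : ℕ} (e : Fin n → A)

/-- `∑ₗ (-1)ˡ dim Extˡ_A(M, N) = ⟨dim M, dim N⟩_A` for all finite dimensional right modules. -/
def CohomologicalHRR : Prop :=
  ∀ (M N : Type u) [AddCommGroup M] [Module k M] [Module Aᵐᵒᵖ M] [IsScalarTower k Aᵐᵒᵖ M]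
    [Module.Finite k M] [AddCommGroup N] [Module k N] [Module Aᵐᵒᵖ N] [IsScalarTower k Aᵐᵒᵖ N]
    [Module.Finite k N],
    IsEulerChar k (fun l => Abelian.Ext.{u} (ModuleCat.of Aᵐᵒᵖ M) (ModuleCat.of Aᵐᵒᵖ N) l)
      (ringelForm (cartanMatrix k e) (dimVecRight k e M) (dimVecRight k e N))

/-- `∑ₗ (-1)ˡ dim Tor_l^A(M, N) = dim N · C_A⁻¹ · dim M` for all finite dimensional right modules
`M` and left modules `N`. The right-hand side is the Ringel form of `Aᵒᵖ`, whose Cartan matrix is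
the transpose of that of `A`. -/
def HomologicalHRR : Prop :=
  ∀ (M N : Type u) [AddCommGroup M] [Module k M] [Module Aᵐᵒᵖ M] [IsScalarTower k Aᵐᵒᵖ M]
    [Module.Finite k M] [AddCommGroup N] [Module k N] [Module A N] [IsScalarTower k A N]
    [Module.Finite k N],
    IsEulerChar k (fun l => Tor k A (ModuleCat.of Aᵐᵒᵖ M) (ModuleCat.of A N) l)
      (dimVecLeft k e N ⬝ᵥ Matrix.mulVec (cartanMatrix k e)⁻¹ (dimVecRight k e M))

/-- `∑ₗ (-1)ˡ dim HHˡ(A, M) = tr(C_A⁻ᵀ · dm M)` for all finite dimensional bimodules. -/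
def HochschildCohomologicalHRR : Prop :=
  ∀ (M : Type u) [AddCommGroup M] [Module k M] [Module A M] [Module Aᵐᵒᵖ M]
    [IsScalarTower k A M] [IsScalarTower k Aᵐᵒᵖ M] [SMulCommClass A Aᵐᵒᵖ M] [Module.Finite k M],
    IsEulerChar k (fun l => HHCohomology k A M l)
      (Matrix.trace (((cartanMatrix k e)⁻¹).transpose * dimMatrix k e M))

/-- `∑ₗ (-1)ˡ dim HH_l(A, M) = tr(C_A⁻¹ · dm M)` for all finite dimensional bimodules. -/
def HochschildHomologicalHRR : Prop :=
  ∀ (M : Type u) [AddCommGroup M] [Module k M] [Module A M] [Module Aᵐᵒᵖ M]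
    [IsScalarTower k A M] [IsScalarTower k Aᵐᵒᵖ M] [SMulCommClass A Aᵐᵒᵖ M] [Module.Finite k M],
    IsEulerChar k (fun l => HHHomology k A M l)
      (Matrix.trace ((cartanMatrix k e)⁻¹ * dimMatrix k e M))

end Formulas

end HRR

end

noncomputable section

namespace HRR

/-! ### Euler characteristics -/

section EulerChar

variable {k : Type v} [Field k]

/-! Everything follows from one formula for the Euler form of Ext over a split basic algebra `R`:
one with complete orthogonal idempotents `e i` and dual characters `χ i`, such that every nonzero
finite-dimensional module contains a one-dimensional submodule given by some `χ i`. Let `S i` be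
these simple modules. If projective dimensions are bounded, Euler characteristics of Ext exist and
are additive in the first variable, so that of `(M, N)` is `dim M · x` with `x i` the value at `(S
i, N)`. For `M = R e i`, which is projective with `Hom(R e i, N) = e i N`, this reads `C x = dim N`.
The case `N = S j` exhibits a right inverse of the Cartan matrix `C`; hence `x = C⁻¹ dim N`
(`IsSplitBasic.isEulerChar_ext`).

This formula is used over four algebras. Over `Aᵐᵒᵖ`, with transposed Cartan matrix, it is formula
1. Over `A`, the isomorphism `Tor_l(M, N)* ≅ Extˡ(N, M*)` turns it into formula 2. Over the opposite
of the enveloping algebra and over the enveloping algebra itself it gives formulas 3 and 4: the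
Cartan matrix is a Kronecker product of `C` and its transpose, the bimodule `A` has `C` itself as
dimension matrix, and the inverse of the Kronecker product cancels to leave a trace.

It remains to see that these algebras qualify. For `A` and `Aᵐᵒᵖ` the characters come from `A / rad
A`, and nilpotence of the radical yields eigenvectors. Finite global dimension passes to opposite
algebras because duality turns bounds on projective dimension into bounds on injective dimension. It
passes to `B ⊗ C` because a simple module `S ⊗ S'` has projective dimension at most the sum of those
of `S` and `S'`, and simple modules control all finite-dimensional ones. -/

theorem finsum_alternating_eq_sum_range {V : ℕ → Type*} [∀ l, AddCommGroup (V l)]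
    [∀ l, Module k (V l)] {d : ℕ} (hd : ∀ l, d < l → Subsingleton (V l)) {N : ℕ} (hN : d < N) :
    ∑ᶠ l : ℕ, (-1 : ℤ) ^ l * (Module.finrank k (V l) : ℤ) =
      ∑ l ∈ Finset.range N, (-1 : ℤ) ^ l * (Module.finrank k (V l) : ℤ) := by
  apply finsum_eq_sum_of_support_subset
  intro l hl
  by_contra h
  have := hd l (by simp at h; omega)
  exact hl (by simp [Module.finrank_zero_of_subsingleton])

theorem isEulerChar_iff_sum_range {V : ℕ → Type u} [∀ l, AddCommGroup (V l)]
    [∀ l, Module k (V l)] {χ : ℤ} : IsEulerChar k V χ ↔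
      (∀ l, Module.Finite k (V l)) ∧ ∃ d, (∀ l, d < l → Subsingleton (V l)) ∧
        ∀ N, d < N → ∑ l ∈ Finset.range N, (-1 : ℤ) ^ l * (Module.finrank k (V l) : ℤ) = χ := by
  constructor
  · rintro ⟨hf, ⟨d, hd⟩, hs⟩
    exact ⟨hf, d, hd, fun N hN => by rw [← finsum_alternating_eq_sum_range hd hN, hs]⟩
  · rintro ⟨hf, d, hd, hs⟩
    exact ⟨hf, ⟨d, hd⟩, by
      rw [finsum_alternating_eq_sum_range hd (Nat.lt_succ_self d), hs _ (Nat.lt_succ_self d)]⟩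

theorem IsEulerChar.unique {V : ℕ → Type u} [∀ l, AddCommGroup (V l)]
    [∀ l, Module k (V l)] {χ χ' : ℤ} (h : IsEulerChar k V χ) (h' : IsEulerChar k V χ') :
    χ = χ' := h.sum_eq.symm.trans h'.sum_eq

/-- Euler characteristics depend only on the dimensions. -/
theorem IsEulerChar.congr {V W : ℕ → Type u} [∀ l, AddCommGroup (V l)]
    [∀ l, Module k (V l)] [∀ l, AddCommGroup (W l)] [∀ l, Module k (W l)] {χ : ℤ}
    (h : IsEulerChar k V χ)
    (hW : ∀ l, Module.Finite k (V l) → Module.Finite k (W l) ∧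
      Module.finrank k (W l) = Module.finrank k (V l)) : IsEulerChar k W χ where
  finite l := (hW l (h.finite l)).1
  bounded := by
    obtain ⟨d, hd⟩ := h.bounded
    refine ⟨d, fun l hl => ?_⟩
    have := hd l hl
    have := (hW l (h.finite l)).1
    exact Module.finrank_zero_iff.mp
      ((hW l (h.finite l)).2.trans Module.finrank_zero_of_subsingleton)
  sum_eq := by
    rw [← h.sum_eq]
    exact finsum_congr fun l => by rw [(hW l (h.finite l)).2]

theorem IsEulerChar.of_subsingleton {V : ℕ → Type u} [∀ l, AddCommGroup (V l)]
    [∀ l, Module k (V l)] (h : ∀ l, Subsingleton (V l)) : IsEulerChar k V 0 where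
  finite l := by have := h l; infer_instance
  bounded := ⟨0, fun l _ => h l⟩
  sum_eq := by
    rw [← finsum_zero (α := ℕ) (M := ℤ)]
    refine finsum_congr fun l => ?_
    have := h l
    simp [Module.finrank_zero_of_subsingleton]

/-- A family concentrated in degree zero. -/
theorem IsEulerChar.of_degree_zero {V : ℕ → Type u} [∀ l, AddCommGroup (V l)]
    [∀ l, Module k (V l)] [Module.Finite k (V 0)] (h : ∀ l, 0 < l → Subsingleton (V l)) :
    IsEulerChar k V (Module.finrank k (V 0)) := by
  refine isEulerChar_iff_sum_range.mpr ⟨fun l => ?_, 0, h, fun N hN => ?_⟩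
  · rcases Nat.eq_zero_or_pos l with rfl | hl
    · infer_instance
    · have := h l hl; infer_instance
  · rw [Finset.sum_eq_single_of_mem 0 (by simpa using hN)]
    · simp
    · intro l _ hl
      have := h l (Nat.pos_of_ne_zero hl)
      simp [Module.finrank_zero_of_subsingleton]

theorem finrank_eq_range_add_range {U V W : Type*} [AddCommGroup U] [Module k U]
    [AddCommGroup V] [Module k V] [AddCommGroup W] [Module k W] [Module.Finite k V]
    {f : U →ₗ[k] V} {g : V →ₗ[k] W} (h : Function.Exact f g) :
    Module.finrank k V =
      Module.finrank k (LinearMap.range f) + Module.finrank k (LinearMap.range g) := by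
  rw [← LinearMap.finrank_range_add_finrank_ker g, LinearMap.exact_iff.mp h, add_comm]

/-- Euler characteristics are additive along long exact sequences
`0 → C⁰ → B⁰ → A⁰ → C¹ → B¹ → A¹ → ⋯`. -/
theorem IsEulerChar.add_of_exact {A B C : ℕ → Type u}
    [∀ l, AddCommGroup (A l)] [∀ l, Module k (A l)]
    [∀ l, AddCommGroup (B l)] [∀ l, Module k (B l)]
    [∀ l, AddCommGroup (C l)] [∀ l, Module k (C l)]
    (α : ∀ l, C l →ₗ[k] B l) (β : ∀ l, B l →ₗ[k] A l) (δ : ∀ l, A l →ₗ[k] C (l + 1))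
    (h₀ : Function.Injective (α 0)) (hB : ∀ l, Function.Exact (α l) (β l))
    (hA : ∀ l, Function.Exact (β l) (δ l)) (hC : ∀ l, Function.Exact (δ l) (α (l + 1)))
    {a c : ℤ} (ha : IsEulerChar k A a) (hc : IsEulerChar k C c) : IsEulerChar k B (a + c) := by
  obtain ⟨fa, da, za, sa⟩ := isEulerChar_iff_sum_range.mp ha
  obtain ⟨fc, dc, zc, sc⟩ := isEulerChar_iff_sum_range.mp hc
  have fB : ∀ l, Module.Finite k (B l) := fun l => by
    have : Module.Finite k (B l ⧸ LinearMap.range (α l)) := by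
      rw [← LinearMap.exact_iff.mp (hB l)]
      exact Module.Finite.equiv (β l).quotKerEquivRange.symm
    exact Module.Finite.of_submodule_quotient (LinearMap.range (α l))
  -- Truncating the long exact sequence after degree `N` spoils additivity only by the rank of the
  -- connecting map that leaves the truncation.
  have hsum : ∀ N, ∑ l ∈ Finset.range (N + 1), (-1 : ℤ) ^ l * (Module.finrank k (B l) : ℤ) =
      ∑ l ∈ Finset.range (N + 1), (-1 : ℤ) ^ l * (Module.finrank k (A l) : ℤ) +
      ∑ l ∈ Finset.range (N + 1), (-1 : ℤ) ^ l * (Module.finrank k (C l) : ℤ) -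
      (-1) ^ N * (Module.finrank k (LinearMap.range (δ N)) : ℤ) := by
    intro N
    induction N with
    | zero =>
      have h1 := finrank_eq_range_add_range (hB 0)
      have h2 := finrank_eq_range_add_range (hA 0)
      have h3 := LinearMap.finrank_range_of_inj h₀
      simp only [zero_add, Finset.sum_range_one, pow_zero, one_mul]
      omega
    | succ N ih =>
      rw [Finset.sum_range_succ, ih, Finset.sum_range_succ _ (N + 1),
        Finset.sum_range_succ _ (N + 1), finrank_eq_range_add_range (hB (N + 1)),
        finrank_eq_range_add_range (hA (N + 1)), finrank_eq_range_add_range (hC N)]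
      push_cast
      ring
  refine isEulerChar_iff_sum_range.mpr ⟨fB, max da dc, fun l hl => ?_, fun N hN => ?_⟩
  · have := za l (by omega)
    have := zc l (by omega)
    refine Module.finrank_zero_iff (R := k).mp ?_
    rw [finrank_eq_range_add_range (hB l), Module.finrank_zero_of_subsingleton (M := LinearMap.range (β l))]
    have : (α l) = 0 := Subsingleton.elim _ _
    simp [this]
  · obtain ⟨N, rfl⟩ : ∃ M, N = M + 1 := ⟨N - 1, by omega⟩
    -- The target of the last connecting map vanishes, so the correction term is zero.
    have := zc (N + 1) (by omega)
    rw [hsum, sa _ (by omega), sc _ (by omega), Module.finrank_zero_of_subsingleton]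
    simp

end EulerChar

/-! ### Dimensions of `Ext` groups over a finite-dimensional algebra -/

section Ext

open Abelian
open scoped ModuleCat

variable {k : Type v} [Field k] {R : Type u} [Ring R] [Algebra k R]

/-- The contravariant long exact sequence of Ext, in which the quotient `S.X₃` comes first. -/
theorem IsEulerChar.ext_of_shortExact {S : ShortComplex (ModuleCat.{u} R)} (hS : S.ShortExact)
    (Y : ModuleCat.{u} R) {a c : ℤ} (ha : IsEulerChar k (fun l => Ext.{u} S.X₁ Y l) a)
    (hc : IsEulerChar k (fun l => Ext.{u} S.X₃ Y l) c) :
    IsEulerChar k (fun l => Ext.{u} S.X₂ Y l) (a + c) := by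
  have := hS.epi_g
  refine IsEulerChar.add_of_exact
    (fun l => (Ext.mk₀ S.g).precompOfLinear k Y (zero_add l))
    (fun l => (Ext.mk₀ S.f).precompOfLinear k Y (zero_add l))
    (fun l => hS.extClass.precompOfLinear k Y (add_comm 1 l)) ?_ (fun l => ?_) (fun l => ?_)
    (fun l => ?_) ha hc
  · exact Ext.precomp_mk₀_injective_of_epi Y S.g
  · exact (ShortComplex.ab_exact_iff_function_exact _).mp
      (Ext.contravariant_sequence_exact₂' hS Y l)
  · exact (ShortComplex.ab_exact_iff_function_exact _).mp
      (Ext.contravariant_sequence_exact₁' hS Y l (l + 1) (add_comm 1 l))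
  · exact (ShortComplex.ab_exact_iff_function_exact _).mp
      (Ext.contravariant_sequence_exact₃' hS Y l (l + 1) (add_comm 1 l))

/-- Objects of `ModuleCat R` carry the `k`-action through `R`. Substituting this equality moves
statements about a given `k`-action to that one. -/
theorem module_eq_restrictScalars {M : Type*} [AddCommGroup M] [i : Module k M] [Module R M]
    [IsScalarTower k R M] : i = Module.restrictScalars k R M :=
  Module.ext' _ _ fun c m => (algebraMap_smul R c m).symm

/-- A finite-dimensional module stays finite-dimensional for the `k`-action through `R`. -/
theorem finite_moduleCat_of (M : Type u) [AddCommGroup M] [i : Module k M] [Module R M]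
    [IsScalarTower k R M] [h : Module.Finite k M] :
    @Module.Finite k (ModuleCat.of R M) _ _ (ModuleCat.moduleOfAlgebraModule _) := by
  have e := module_eq_restrictScalars (k := k) (R := R) (i := i)
  subst e
  exact h

theorem finite_of_shortExact₁ {S : ShortComplex (ModuleCat.{u} R)} (hS : S.ShortExact)
    [Module.Finite k S.X₂] : Module.Finite k S.X₁ :=
  Module.Finite.of_injective (S.f.hom.restrictScalars k) hS.moduleCat_injective_f

theorem finite_of_shortExact₃ {S : ShortComplex (ModuleCat.{u} R)} (hS : S.ShortExact)
    [Module.Finite k S.X₂] : Module.Finite k S.X₃ :=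
  Module.Finite.of_surjective (S.g.hom.restrictScalars k) hS.moduleCat_surjective_g

variable (k) in
/-- Every finite-dimensional module is a quotient of a finite free one. -/
theorem exists_free_shortExact [Module.Finite k R] (M : ModuleCat.{u} R) [Module.Finite k M] :
    ∃ (n : ℕ) (K : ModuleCat.{u} R) (f : K ⟶ ModuleCat.of R (Fin n → R))
      (g : ModuleCat.of R (Fin n → R) ⟶ M) (w : f ≫ g = 0),
      (ShortComplex.mk f g w).ShortExact ∧ Module.Finite k K := by
  have : Module.Finite R M := Module.Finite.of_restrictScalars_finite k R M
  obtain ⟨n, f, hf⟩ := Module.Finite.exists_fin' R M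
  refine ⟨n, _, _, _, _, LinearMap.shortExact_shortComplexKer hf, ?_⟩
  have := finite_moduleCat_of (k := k) (R := R) (Fin n → R)
  exact finite_of_shortExact₁ (LinearMap.shortExact_shortComplexKer hf)

theorem finite_hom (M N : ModuleCat.{u} R) [Module.Finite k M] [Module.Finite k N] :
    Module.Finite k (M ⟶ N) := by
  let φ : (M ⟶ N) →ₗ[k] (M →ₗ[k] N) :=
    { toFun f := f.hom.restrictScalars k
      map_add' _ _ := rfl
      map_smul' _ _ := rfl }
  refine Module.Finite.of_injective φ fun f g h => ?_
  ext x
  exact LinearMap.congr_fun h x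

instance projective_of_free (n : ℕ) : Projective (ModuleCat.of R (Fin n → R)) :=
  (IsProjective.iff_projective _).mp inferInstance

/-- Dimension shifting: for a finite free cover of `M` with kernel `K`, the connecting map from
`Extˡ(K, N)` onto `Extˡ⁺¹(M, N)` is surjective. -/
theorem finite_ext [Module.Finite k R] (M N : ModuleCat.{u} R) [Module.Finite k M]
    [Module.Finite k N] (l : ℕ) : Module.Finite k (Ext.{u} M N l) := by
  induction l generalizing M with
  | zero =>
    have := finite_hom (k := k) M N
    exact Module.Finite.equiv (Ext.linearEquiv₀ (R := k)).symm
  | succ l ih =>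
    obtain ⟨n, K, f, g, w, hS, hK⟩ := exists_free_shortExact k M
    have := ih K
    exact Module.Finite.of_surjective (hS.extClass.precompOfLinear k N (add_comm 1 l))
      (precomp_extClass_surjective_of_projective_X₂ N hS l)

end Ext

/-! ### Split basic data: characters and composition series -/

section Characters

open Abelian
open scoped ModuleCat

variable {k : Type v} [Field k] {R : Type u} [Ring R] [Algebra k R] {ι : Type}

/-- Every nonzero finite-dimensional module has a common eigenvector, on which the algebra acts
through one of the characters `χ i`. -/
def HasEigenvectors (χ : ι → R →ₐ[k] k) : Prop :=
  ∀ (M : ModuleCat.{u} R) [Module.Finite k M] [Nontrivial M],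
    ∃ (i : ι) (v : M), v ≠ 0 ∧ ∀ r : R, r • v = χ i r • v

/-- The one-dimensional module attached to a character. -/
def simpleModule (χ : R →ₐ[k] k) : ModuleCat.{u} R := ModuleCat.of R (R ⧸ RingHom.ker χ)

instance finite_simpleModule [Module.Finite k R] (χ : R →ₐ[k] k) :
    Module.Finite k (simpleModule χ) :=
  finite_moduleCat_of (R ⧸ RingHom.ker χ)

/-- The generator of the one-dimensional module attached to a character. -/
def simpleModule.gen (χ : R →ₐ[k] k) : simpleModule χ := Submodule.Quotient.mk (1 : R)

theorem simpleModule.exists_smul_gen (χ : R →ₐ[k] k) (x : simpleModule χ) :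
    ∃ r : R, x = r • simpleModule.gen χ := by
  obtain ⟨r, rfl⟩ := Submodule.Quotient.mk_surjective _ x
  exact ⟨r, congrArg Submodule.Quotient.mk (mul_one r).symm⟩

theorem simpleModule.smul_gen_eq_zero_iff (χ : R →ₐ[k] k) (r : R) :
    r • simpleModule.gen χ = 0 ↔ χ r = 0 := by
  have : r • simpleModule.gen χ = Submodule.Quotient.mk (p := RingHom.ker χ) r :=
    congrArg Submodule.Quotient.mk (mul_one r)
  rw [this, ← RingHom.mem_ker]
  exact Submodule.Quotient.mk_eq_zero _

theorem simpleModule.smul_gen (χ : R →ₐ[k] k) (r : R) :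
    r • simpleModule.gen χ = χ r • simpleModule.gen χ := by
  rw [← sub_eq_zero, ← algebraMap_smul R (χ r), ← sub_smul, smul_gen_eq_zero_iff]
  simp

theorem simpleModule.smul_eq (χ : R →ₐ[k] k) (r : R) (x : simpleModule χ) :
    r • x = χ r • x := by
  obtain ⟨s, rfl⟩ := exists_smul_gen χ x
  rw [← mul_smul, smul_gen, smul_gen χ s, map_mul, mul_smul]

theorem simpleModule.gen_ne_zero (χ : R →ₐ[k] k) : simpleModule.gen χ ≠ 0 := by
  have := (smul_gen_eq_zero_iff χ 1).not
  simpa using this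

theorem simpleModule.finrank_eq_one (χ : R →ₐ[k] k) :
    Module.finrank k (simpleModule χ) = 1 := by
  refine _root_.finrank_eq_one (simpleModule.gen χ) (gen_ne_zero χ) fun x => ?_
  obtain ⟨r, rfl⟩ := exists_smul_gen χ x
  exact ⟨χ r, (smul_gen χ r).symm⟩

/-- An eigenvector defines an embedding of a one-dimensional module. -/
theorem exists_mono_of_eigenvector (χ : R →ₐ[k] k) (M : ModuleCat.{u} R) (v : M) (hv : v ≠ 0)
    (h : ∀ r : R, r • v = χ r • v) :
    ∃ f : simpleModule χ →ₗ[R] M, Function.Injective f ∧ f (simpleModule.gen χ) = v := by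
  have hle : RingHom.ker χ ≤ LinearMap.ker (LinearMap.toSpanSingleton R M v) := fun r hr => by
    have hr : χ r = 0 := hr
    simp [h, hr]
  let f : simpleModule χ →ₗ[R] M := Submodule.liftQ _ (LinearMap.toSpanSingleton R M v) hle
  have hf : f (simpleModule.gen χ) = v := by
    refine (Submodule.liftQ_apply _ _ _).trans ?_
    simp
  refine ⟨f, (injective_iff_map_eq_zero _).mpr fun x hx => ?_, hf⟩
  obtain ⟨r, rfl⟩ := simpleModule.exists_smul_gen χ x
  rw [map_smul, hf, h] at hx
  rw [simpleModule.smul_gen, (smul_eq_zero.mp hx).resolve_right hv, zero_smul]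

theorem finrank_of_shortExact {S : ShortComplex (ModuleCat.{u} R)} (hS : S.ShortExact)
    [Module.Finite k S.X₂] :
    Module.finrank k S.X₂ = Module.finrank k S.X₁ + Module.finrank k S.X₃ := by
  have e : Function.Exact (S.f.hom.restrictScalars k) (S.g.hom.restrictScalars k) :=
    (ShortComplex.ShortExact.moduleCat_exact_iff_function_exact _).mp hS.exact
  have h1 := finrank_eq_range_add_range e
  have h2 := LinearMap.finrank_range_of_inj (f := S.f.hom.restrictScalars k)
    hS.moduleCat_injective_f
  have h4 : LinearMap.range (S.g.hom.restrictScalars k) = ⊤ :=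
    LinearMap.range_eq_top.mpr hS.moduleCat_surjective_g
  rw [h4, finrank_top, h2] at h1
  exact h1

/-- Induction along composition series of finite-dimensional modules. -/
theorem HasEigenvectors.induction {χ : ι → R →ₐ[k] k} (hχ : HasEigenvectors χ)
    {P : ModuleCat.{u} R → Prop} (zero : ∀ M : ModuleCat.{u} R, Subsingleton M → P M)
    (simple : ∀ i, P (simpleModule (χ i)))
    (ext : ∀ S : ShortComplex (ModuleCat.{u} R), S.ShortExact → Module.Finite k S.X₂ →
      P S.X₁ → P S.X₃ → P S.X₂)
    (M : ModuleCat.{u} R) [Module.Finite k M] : P M := by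
  induction hd : Module.finrank k M using Nat.strong_induction_on generalizing M with
  | _ d ih =>
  rcases subsingleton_or_nontrivial M with hM | hM
  · exact zero M hM
  obtain ⟨i, v, hv, h⟩ := hχ M
  obtain ⟨f, hf, -⟩ := exists_mono_of_eigenvector (χ i) M v hv h
  let S : ShortComplex (ModuleCat.{u} R) :=
    ShortComplex.mk (ModuleCat.ofHom f) (ModuleCat.ofHom (LinearMap.range f).mkQ)
      (by ext; simp)
  have hS : S.ShortExact := by
    have : Mono S.f := (ModuleCat.mono_iff_injective _).mpr hf
    have : Epi S.g := (ModuleCat.epi_iff_surjective _).mpr (Submodule.mkQ_surjective _)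
    refine ShortComplex.ShortExact.mk ?_
    rw [ShortComplex.ShortExact.moduleCat_exact_iff_function_exact]
    exact LinearMap.exact_map_mkQ_range f
  have hfin : Module.Finite k S.X₂ := ‹_›
  have : Module.Finite k S.X₃ := finite_of_shortExact₃ hS
  refine ext S hS hfin (simple i) (ih _ ?_ S.X₃ rfl)
  rw [← hd]
  have h1 := finrank_of_shortExact (k := k) hS
  have h3 : Module.finrank k S.X₁ = 1 := simpleModule.finrank_eq_one (χ i)
  change Module.finrank k S.X₃ < Module.finrank k S.X₂
  omega

end Characters

/-! ### Dimension vectors -/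

section DimVec

open Abelian
open scoped ModuleCat

variable (k : Type v) [Field k] {R : Type u} [Ring R] [Algebra k R]

/-- The dimension of `a M`. -/
def dimAt (a : R) (M : ModuleCat.{u} R) : ℕ :=
  Module.finrank k (LinearMap.range (Algebra.lsmul k k M a))

theorem dimAt_of_subsingleton (a : R) (M : ModuleCat.{u} R) [Subsingleton M] : dimAt k a M = 0 :=
  Module.finrank_zero_of_subsingleton

variable {k}

/-- For an idempotent `a` the functor `M ↦ a M` is exact: a preimage `y` of an element of `a M` can
be replaced by `a y`. -/
theorem dimAt_of_shortExact {a : R} (ha : IsIdempotentElem a)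
    {S : ShortComplex (ModuleCat.{u} R)} (hS : S.ShortExact) [Module.Finite k S.X₂] :
    dimAt k a S.X₂ = dimAt k a S.X₁ + dimAt k a S.X₃ := by
  let F : ∀ {X Y : ModuleCat.{u} R} (f : X ⟶ Y),
      LinearMap.range (Algebra.lsmul k k X a) →ₗ[k] LinearMap.range (Algebra.lsmul k k Y a) :=
    fun f => (f.hom.restrictScalars k).restrict (by
      rintro _ ⟨x, rfl⟩
      exact ⟨f.hom x, by simp⟩)
  have hinj : Function.Injective (F S.f) := fun x y h =>
    Subtype.ext (hS.moduleCat_injective_f (congrArg Subtype.val h))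
  have hsurj : Function.Surjective (F S.g) := by
    rintro ⟨_, ⟨y, rfl⟩⟩
    obtain ⟨x, rfl⟩ := hS.moduleCat_surjective_g y
    exact ⟨⟨_, ⟨x, rfl⟩⟩, Subtype.ext (by simp [F])⟩
  have hex := (ShortComplex.ShortExact.moduleCat_exact_iff_function_exact _).mp hS.exact
  have hexact : Function.Exact (F S.f) (F S.g) := by
    rintro ⟨_, ⟨x, rfl⟩⟩
    constructor
    · intro h
      obtain ⟨y, hy⟩ := (hex _).mp (congrArg Subtype.val h)
      refine ⟨⟨_, ⟨y, rfl⟩⟩, Subtype.ext ?_⟩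
      change S.f.hom (a • y) = a • x
      rw [map_smul]
      refine (congrArg (a • ·) hy).trans ?_
      change a • a • x = a • x
      rw [← mul_smul, ha.eq]
    · rintro ⟨y, hy⟩
      rw [← hy]
      exact Subtype.ext ((hex _).mpr ⟨_, rfl⟩)
  have h1 := finrank_eq_range_add_range hexact
  rw [LinearMap.finrank_range_of_inj hinj, LinearMap.range_eq_top.mpr hsurj, finrank_top] at h1
  exact h1

open Classical in
theorem dimAt_simpleModule (χ : R →ₐ[k] k) {a : R} :
    dimAt k a (simpleModule χ) = if χ a = 0 then 0 else 1 := by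
  have h : Algebra.lsmul k k (simpleModule χ) a = χ a • LinearMap.id :=
    LinearMap.ext fun x => simpleModule.smul_eq χ a x
  rw [dimAt, h]
  split_ifs with h0
  · rw [h0, zero_smul, LinearMap.range_zero, finrank_bot]
  · rw [LinearMap.range_smul _ _ h0, LinearMap.range_id, finrank_top,
      simpleModule.finrank_eq_one]

end DimVec

/-! ### The Euler form of a split basic algebra of finite global dimension -/

section EulerForm

open Abelian
open scoped ModuleCat

variable {k : Type v} [Field k] {R : Type u} [Ring R] [Algebra k R]

/-- The left module `R a`. -/
def principalModule (a : R) : ModuleCat.{u} R := ModuleCat.of R (Submodule.span R {a})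

theorem mem_span_singleton_idempotent {a : R} (ha : IsIdempotentElem a) {x : R} :
    x ∈ Submodule.span R {a} ↔ x * a = x := by
  rw [Submodule.mem_span_singleton]
  constructor
  · rintro ⟨r, rfl⟩
    rw [smul_eq_mul, mul_assoc, ha.eq]
  · exact fun h => ⟨x, h⟩

instance finite_principalModule [Module.Finite k R] (a : R) :
    Module.Finite k (principalModule a) :=
  finite_moduleCat_of (Submodule.span R {a})

/-- Right multiplication by `a` splits the inclusion of `R a` in `R`. -/
theorem projective_principalModule {a : R} (ha : IsIdempotentElem a) :
    Projective (principalModule a) := by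
  refine (IsProjective.iff_projective _).mp ?_
  refine Module.Projective.of_split (P := Submodule.span R {a}) (M := R)
    (Submodule.subtype _)
    ((LinearMap.toSpanSingleton R R a).codRestrict _ fun r =>
      Submodule.mem_span_singleton.mpr ⟨r, rfl⟩) ?_
  ext x
  exact (mem_span_singleton_idempotent ha).mp x.2

/-- `Hom_R(R a, N) ≅ a N` for an idempotent `a`. -/
theorem finrank_hom_principalModule {a : R} (ha : IsIdempotentElem a) (N : ModuleCat.{u} R) :
    Module.finrank k (principalModule a ⟶ N) = dimAt k a N := by
  let g : principalModule a := ⟨a, Submodule.mem_span_singleton_self a⟩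
  have hg : a • g = g := Subtype.ext ha.eq
  let φ : (principalModule a ⟶ N) →ₗ[k] N :=
    { toFun f := f.hom g
      map_add' _ _ := rfl
      map_smul' _ _ := rfl }
  have hφ : Function.Injective φ := fun f f' h => by
    ext ⟨x, hx⟩
    obtain ⟨r, rfl⟩ := Submodule.mem_span_singleton.mp hx
    have e : (⟨r • a, hx⟩ : principalModule a) = r • g := rfl
    rw [e]
    refine (map_smul f.hom r g).trans (Eq.trans ?_ (map_smul f'.hom r g).symm)
    exact congrArg (r • ·) h
  have hr : LinearMap.range φ = LinearMap.range (Algebra.lsmul k k N a) := by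
    apply le_antisymm
    · rintro _ ⟨f, rfl⟩
      refine ⟨f.hom g, ?_⟩
      change a • f.hom g = f.hom g
      rw [← map_smul, hg]
    · rintro _ ⟨x, rfl⟩
      refine ⟨ModuleCat.ofHom
        ((LinearMap.toSpanSingleton R N x) ∘ₗ (Submodule.span R {a}).subtype), ?_⟩
      rfl
  rw [dimAt, ← hr, LinearMap.finrank_range_of_inj hφ]

theorem isEulerChar_principalModule [Module.Finite k R] {a : R} (ha : IsIdempotentElem a)
    (N : ModuleCat.{u} R) [Module.Finite k N] :
    IsEulerChar k (fun l => Ext.{u} (principalModule a) N l) (dimAt k a N) := by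
  have := projective_principalModule ha
  have h1 : Module.finrank k (Ext.{u} (principalModule a) N 0) = dimAt k a N := by
    rw [← finrank_hom_principalModule ha N]
    exact (Ext.linearEquiv₀ (R := k)).finrank_eq
  rw [← h1]
  have := finite_ext (k := k) (principalModule a) N 0
  exact IsEulerChar.of_degree_zero (V := fun l => Ext.{u} (principalModule a) N l) fun l hl =>
    HasProjectiveDimensionLT.subsingleton (principalModule a) 1 l hl N

/-- Makes the dimension vector of `R (e i)` the `i`-th row of the Cartan matrix. -/
theorem dimAt_principalModule {a b : R} (hb : IsIdempotentElem b) :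
    dimAt k a (principalModule b) =
      Module.finrank k (LinearMap.range (LinearMap.mulLeft k a ∘ₗ LinearMap.mulRight k b)) := by
  let ψ : principalModule b →ₗ[k] R :=
    { toFun x := x.1
      map_add' _ _ := rfl
      map_smul' c x := (algebraMap_smul R c x.1) }
  have hψ : Function.Injective ψ := fun x y h => Subtype.ext h
  have key : Submodule.map ψ (LinearMap.range (Algebra.lsmul k k (principalModule b) a)) =
      LinearMap.range (LinearMap.mulLeft k a ∘ₗ LinearMap.mulRight k b) := by
    ext y
    constructor
    · rintro ⟨_, ⟨x, rfl⟩, rfl⟩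
      refine ⟨x.1, ?_⟩
      change a * (x.1 * b) = a * x.1
      rw [(mem_span_singleton_idempotent hb).mp x.2]
    · rintro ⟨x, rfl⟩
      exact ⟨_, ⟨⟨x * b, Submodule.mem_span_singleton.mpr ⟨x, rfl⟩⟩, rfl⟩, rfl⟩
  rw [dimAt, LinearEquiv.finrank_eq (Submodule.equivMapOfInjective ψ hψ _), key]

variable {ι : Type} [Fintype ι]

/-- A complete family of orthogonal idempotents `e i` together with characters `χ i` dual to it,
through which all simple modules factor. -/
structure IsSplitBasic (e : ι → R) (χ : ι → R →ₐ[k] k) : Prop where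
  complete : CompleteOrthogonalIdempotents e
  apply_same : ∀ i, χ i (e i) = 1
  apply_ne : ∀ i j, i ≠ j → χ i (e j) = 0
  eigen : HasEigenvectors χ

variable (k R) in
/-- The projective dimensions of finite-dimensional left modules are bounded. -/
def HasFiniteModGldim : Prop :=
  ∃ d : ℕ, ∀ M : ModuleCat.{u} R, Module.Finite k M → HasProjectiveDimensionLT M d

variable (k) in
/-- The matrix with entries `dim eⱼ R eᵢ`. -/
def cartan (e : ι → R) : Matrix ι ι ℤ := Matrix.of fun i j =>
  (Module.finrank k (LinearMap.range
    (LinearMap.mulLeft k (e j) ∘ₗ LinearMap.mulRight k (e i))) : ℤ)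

variable (k) in
/-- The dimension vector of a left module. -/
def dimVec (e : ι → R) (M : ModuleCat.{u} R) : ι → ℤ := fun i => (dimAt k (e i) M : ℤ)

variable {e : ι → R} {χ : ι → R →ₐ[k] k}

/-- Both sides are additive in `M`, so composition factors suffice; the dimension vector of the
`i`-th simple module is the `i`-th unit vector. -/
theorem IsSplitBasic.isEulerChar_of_simple (h : IsSplitBasic e χ) (N : ModuleCat.{u} R)
    {x : ι → ℤ} (hx : ∀ i, IsEulerChar k (fun l => Ext.{u} (simpleModule (χ i)) N l) (x i))
    (M : ModuleCat.{u} R) [Module.Finite k M] :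
    IsEulerChar k (fun l => Ext.{u} M N l) (dimVec k e M ⬝ᵥ x) := by
  classical
  refine h.eigen.induction (P := fun M => IsEulerChar k (fun l => Ext.{u} M N l)
    (dimVec k e M ⬝ᵥ x)) (fun M hM => ?_) (fun i => ?_) (fun S hS hfin h₁ h₃ => ?_) M
  · have : dimVec k e M = 0 := funext fun i => by
      simp [dimVec, dimAt_of_subsingleton]
    rw [this, zero_dotProduct]
    have hz : Limits.IsZero M := ModuleCat.isZero_of_subsingleton M
    have := hz.hasProjectiveDimensionLT_zero
    exact IsEulerChar.of_subsingleton fun l =>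
      HasProjectiveDimensionLT.subsingleton M 0 l (Nat.zero_le l) N
  · have : dimVec k e (simpleModule (χ i)) = Pi.single i 1 := funext fun j => by
      rw [dimVec, dimAt_simpleModule]
      rcases eq_or_ne i j with rfl | hij
      · simp [h.apply_same]
      · simp [h.apply_ne i j hij, hij.symm]
    rw [this, single_one_dotProduct]
    exact hx i
  · have : dimVec k e S.X₂ = dimVec k e S.X₁ + dimVec k e S.X₃ := funext fun j => by
      simp [dimVec, dimAt_of_shortExact (h.complete.idem j) hS]
    rw [this, add_dotProduct]
    exact IsEulerChar.ext_of_shortExact hS N h₁ h₃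

theorem IsSplitBasic.exists_eulerChar_simple [Module.Finite k R]
    (hd : HasFiniteModGldim k R) (N : ModuleCat.{u} R) [Module.Finite k N] (χ : R →ₐ[k] k) :
    ∃ x : ℤ, IsEulerChar k (fun l => Ext.{u} (simpleModule χ) N l) x := by
  obtain ⟨d, hd⟩ := hd
  have := hd (simpleModule χ) inferInstance
  exact ⟨_, fun l => finite_ext _ _ l, ⟨d, fun l hl =>
    HasProjectiveDimensionLT.subsingleton _ d l hl.le N⟩, rfl⟩

/-- The Euler characteristic of `(R (e i), N)` is computed twice: from composition factors and from
projectivity. -/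
theorem IsSplitBasic.cartan_mulVec [Module.Finite k R] (h : IsSplitBasic e χ)
    (N : ModuleCat.{u} R) [Module.Finite k N] {x : ι → ℤ}
    (hx : ∀ i, IsEulerChar k (fun l => Ext.{u} (simpleModule (χ i)) N l) (x i)) :
    Matrix.mulVec (cartan k e) x = dimVec k e N := by
  funext i
  have h1 := h.isEulerChar_of_simple N hx (principalModule (e i))
  have h2 := isEulerChar_principalModule (k := k) (h.complete.idem i) N
  have h3 : dimVec k e (principalModule (e i)) = cartan k e i := funext fun j => by
    simp [dimVec, cartan, dimAt_principalModule (h.complete.idem i)]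
  rw [h3] at h1
  exact h1.unique h2

/-- With `N` running through the simple modules, the right-hand sides of `cartan_mulVec` are the
unit vectors, so the Euler matrix of the simple modules is a right inverse over the integers. -/
theorem IsSplitBasic.isUnit_det_cartan [DecidableEq ι] [Module.Finite k R]
    (h : IsSplitBasic e χ) (hd : HasFiniteModGldim k R) : IsUnit (cartan k e).det := by
  choose x hx using fun i j => exists_eulerChar_simple hd (simpleModule (χ j)) (χ i)
  have : cartan k e * Matrix.of x = 1 := by
    ext i j
    have := congrFun (h.cartan_mulVec (simpleModule (χ j)) (x := fun i => x i j)
      fun i => hx i j) i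
    refine Eq.trans (by rfl) (this.trans ?_)
    rw [dimVec, dimAt_simpleModule]
    rcases eq_or_ne i j with rfl | hij
    · simp [h.apply_same]
    · simp [h.apply_ne j i hij.symm, hij]
  exact (Matrix.isUnit_iff_isUnit_det _).mp (IsUnit.of_mul_eq_one _ this)

theorem IsSplitBasic.isEulerChar_ext [DecidableEq ι] [Module.Finite k R]
    (h : IsSplitBasic e χ) (hd : HasFiniteModGldim k R) (M N : ModuleCat.{u} R)
    [Module.Finite k M] [Module.Finite k N] :
    IsEulerChar k (fun l => Ext.{u} M N l)
      (dimVec k e M ⬝ᵥ Matrix.mulVec (cartan k e)⁻¹ (dimVec k e N)) := by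
  choose x hx using fun i => exists_eulerChar_simple hd N (χ i)
  have h1 := h.isEulerChar_of_simple N hx M
  have h2 := h.cartan_mulVec N hx
  rwa [← h2, Matrix.mulVec_mulVec, Matrix.nonsing_inv_mul _ (h.isUnit_det_cartan hd),
    Matrix.one_mulVec]

end EulerForm

/-! ### Bounding homological dimensions along finite free resolutions -/

section Resolution

open Abelian
open scoped ModuleCat

variable {k : Type v} [Field k] {R : Type u} [Ring R] [Algebra k R]

theorem shortExact_mk_of_exact {X Y Z : Type u} [AddCommGroup X] [AddCommGroup Y] [AddCommGroup Z]
    [Module R X] [Module R Y] [Module R Z] {f : X →ₗ[R] Y} {g : Y →ₗ[R] Z}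
    (hf : Function.Injective f) (hg : Function.Surjective g) (h : Function.Exact f g) :
    (ShortComplex.mk (ModuleCat.ofHom f) (ModuleCat.ofHom g)
      (by ext x; exact h.apply_apply_eq_zero x)).ShortExact := by
  have : Mono (ModuleCat.ofHom f) := (ModuleCat.mono_iff_injective _).mpr hf
  have : Epi (ModuleCat.ofHom g) := (ModuleCat.epi_iff_surjective _).mpr hg
  refine ShortComplex.ShortExact.mk ?_
  rw [ShortComplex.ShortExact.moduleCat_exact_iff_function_exact]
  exact h

/-- A property closed under extensions that holds for the regular module holds for all finite
free modules. -/
theorem free_induction {Q : ModuleCat.{u} R → Prop}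
    (zero : ∀ X : ModuleCat.{u} R, Subsingleton X → Q X) (self : Q (ModuleCat.of R R))
    (ext : ∀ S : ShortComplex (ModuleCat.{u} R), S.ShortExact → Q S.X₁ → Q S.X₃ → Q S.X₂) (n : ℕ) :
    Q (ModuleCat.of R (Fin n → R)) := by
  induction n with
  | zero => exact zero _ (inferInstanceAs (Subsingleton (Fin 0 → R)))
  | succ n ih =>
    have h : Function.Exact (LinearMap.single R (fun _ : Fin (n + 1) => R) 0)
        (LinearMap.funLeft R R Fin.succ) := by
      intro x
      constructor
      · intro hx
        refine ⟨x 0, funext fun i => ?_⟩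
        refine Fin.cases (by simp) (fun j => ?_) i
        have := congrFun hx j
        simpa using this.symm
      · rintro ⟨y, rfl⟩
        funext j
        simp [LinearMap.funLeft]
    exact ext _ (shortExact_mk_of_exact (f := LinearMap.single R (fun _ : Fin (n + 1) => R) 0)
      (Pi.single_injective (M := fun _ : Fin (n + 1) => R) 0)
      (LinearMap.funLeft_surjective_of_injective R R _ (Fin.succ_injective n)) h) self ih

variable (k) in
/-- Induction on the projective dimension of finite-dimensional modules. -/
theorem projectiveDimension_induction [Module.Finite k R] {Q : ℕ → ModuleCat.{u} R → Prop}
    (zero : ∀ X : ModuleCat.{u} R, Subsingleton X → Q 0 X) (self : Q 0 (ModuleCat.of R R))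
    (ext : ∀ S : ShortComplex (ModuleCat.{u} R), S.ShortExact → Q 0 S.X₁ → Q 0 S.X₃ → Q 0 S.X₂)
    (retract : ∀ X Y : ModuleCat.{u} R, Retract X Y → Q 0 Y → Q 0 X)
    (step : ∀ (n : ℕ) (S : ShortComplex (ModuleCat.{u} R)), S.ShortExact → Q n S.X₁ → Q 0 S.X₂ →
      Q (n + 1) S.X₃)
    (d : ℕ) (X : ModuleCat.{u} R) [Module.Finite k X] (hX : HasProjectiveDimensionLE X d) :
    Q d X := by
  induction d generalizing X with
  | zero =>
    obtain ⟨n, K, f, g, w, hS, hK⟩ := exists_free_shortExact k X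
    have : Epi g := hS.epi_g
    have : Projective X := (projective_iff_hasProjectiveDimensionLE_zero X).mpr hX
    -- A projective module is a retract of its finite free cover.
    exact retract X _ ⟨Projective.factorThru (𝟙 X) g, g, Projective.factorThru_comp _ _⟩
      (free_induction zero self ext n)
  | succ d ih =>
    obtain ⟨n, K, f, g, w, hS, hK⟩ := exists_free_shortExact k X
    refine step d _ hS (ih K ?_) (free_induction zero self ext n)
    exact hS.hasProjectiveDimensionLT_X₁ (d + 1)
      (hasProjectiveDimensionLT_of_ge _ 1 _ (by omega)) hX

/-- Vanishing of `Ext` against finite-dimensional modules bounds the projective dimension of a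
finite-dimensional module. -/
theorem hasProjectiveDimensionLE_of_ext_eq_zero [Module.Finite k R] (d : ℕ) (M : ModuleCat.{u} R)
    [Module.Finite k M]
    (h : ∀ N : ModuleCat.{u} R, Module.Finite k N → Subsingleton (Ext.{u} M N (d + 1))) :
    HasProjectiveDimensionLE M d := by
  induction d generalizing M with
  | zero =>
    obtain ⟨n, K, f, g, w, hS, hK⟩ := exists_free_shortExact k M
    -- The test module is the kernel `K` of the free cover: as `Ext¹(M, K) = 0`, the identity of `M`
    -- lifts and the cover splits.
    obtain ⟨x, hx⟩ := Ext.covariant_sequence_exact₃ M hS (Ext.mk₀ (𝟙 M)) (zero_add 1)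
      (by have := h K hK; exact Subsingleton.elim _ _)
    obtain ⟨s, rfl⟩ := Ext.homEquiv₀.symm.surjective x
    have hs : s ≫ g = 𝟙 M := by
      apply Ext.homEquiv₀.symm.injective
      simpa using hx
    exact (Retract.mk s g hs).hasProjectiveDimensionLT 1
  | succ d ih =>
    obtain ⟨n, K, f, g, w, hS, hK⟩ := exists_free_shortExact k M
    refine hS.hasProjectiveDimensionLT_X₃ (d + 1) (ih K fun N hN => ?_)
      (hasProjectiveDimensionLT_of_ge _ 1 _ (by omega))
    have := h N hN
    refine ⟨fun x y => ?_⟩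
    rw [← sub_eq_zero]
    obtain ⟨z, hz⟩ := Ext.contravariant_sequence_exact₁ hS N (x - y) (add_comm 1 (d + 1))
      (Subsingleton.elim _ _)
    rw [← hz, Ext.eq_zero_of_hasProjectiveDimensionLT z 1 (by omega), Ext.comp_zero]

variable {ι : Type}

/-- A common bound for the finitely many simple modules survives extensions, hence holds along
composition series. -/
theorem HasEigenvectors.hasFiniteModGldim [Finite ι] {χ : ι → R →ₐ[k] k} (hχ : HasEigenvectors χ)
    (h : ∀ i, ∃ d, HasProjectiveDimensionLT (simpleModule (χ i)) d) : HasFiniteModGldim k R := by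
  cases nonempty_fintype ι
  choose d hd using h
  refine ⟨Finset.univ.sup d, fun M hM => ?_⟩
  refine hχ.induction (P := fun M => HasProjectiveDimensionLT M (Finset.univ.sup d))
    (fun M hM => ?_) (fun i => ?_) (fun S hS _ h₁ h₃ => ?_) M
  · have := (ModuleCat.isZero_of_subsingleton M).hasProjectiveDimensionLT_zero
    exact hasProjectiveDimensionLT_of_ge _ 0 _ (Nat.zero_le _)
  · have := hd i
    exact hasProjectiveDimensionLT_of_ge _ (d i) _ (Finset.le_sup (Finset.mem_univ i))
  · exact hS.hasProjectiveDimensionLT_X₂ _ h₁ h₃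

theorem HasEigenvectors.hasInjectiveDimensionLT {χ : ι → R →ₐ[k] k} (hχ : HasEigenvectors χ)
    {d : ℕ} (h : ∀ i, HasInjectiveDimensionLT (simpleModule (χ i)) d) (M : ModuleCat.{u} R)
    [Module.Finite k M] : HasInjectiveDimensionLT M d := by
  refine hχ.induction (P := fun M => HasInjectiveDimensionLT M d)
    (fun M hM => ?_) (fun i => h i) (fun S hS _ h₁ h₃ => ?_) M
  · have := (ModuleCat.isZero_of_subsingleton M).hasInjectiveDimensionLT_zero
    exact hasInjectiveDimensionLT_of_ge _ 0 _ (Nat.zero_le _)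
  · exact hS.hasInjectiveDimensionLT_X₂ _ h₁ h₃

end Resolution

/-! ### Vector space duality between left and right modules -/

section Duality

open Abelian
open scoped ModuleCat

variable {k : Type v} [Field k] {R S : Type u} [Ring R] [Algebra k R] [Ring S] [Algebra k S]

theorem simpleModule.nonempty_iso (χ : R →ₐ[k] k) (M : ModuleCat.{u} R)
    (hM : Module.finrank k M = 1) (h : ∀ (r : R) (m : M), r • m = χ r • m) :
    Nonempty (simpleModule χ ≅ M) := by
  have : Module.Finite k M := Module.finite_of_finrank_eq_succ hM
  have : Nontrivial M := Module.nontrivial_of_finrank_pos (R := k) (by omega)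
  obtain ⟨v, hv⟩ := exists_ne (0 : M)
  obtain ⟨f, hf, hfv⟩ := exists_mono_of_eigenvector χ M v hv (fun r => h r v)
  refine ⟨(LinearEquiv.ofBijective f ⟨hf, fun m => ?_⟩).toModuleIso⟩
  obtain ⟨c, rfl⟩ := (finrank_eq_one_iff_of_nonzero' v hv).mp hM m
  exact ⟨algebraMap k R c • simpleModule.gen χ, by rw [map_smul, hfv, algebraMap_smul]⟩

/-- The character of the opposite algebra attached to a character. -/
def oppositeCharacter (φ : R ≃ₐ[k] Sᵐᵒᵖ) (χ : R →ₐ[k] k) : S →ₐ[k] k :=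
  AlgHom.ofLinearMap (χ.toLinearMap ∘ₗ φ.symm.toLinearMap ∘ₗ (opLinearEquiv k).toLinearMap)
    (by simp) (fun x y => by simp [mul_comm])

theorem oppositeCharacter_apply (φ : R ≃ₐ[k] Sᵐᵒᵖ) (χ : R →ₐ[k] k) (r : R) :
    oppositeCharacter φ χ (unop (φ r)) = χ r := by
  simp [oppositeCharacter]

variable [Small.{u} k]

/-- The underlying space of the dual of a module. -/
def DualSpace (_ : R ≃ₐ[k] Sᵐᵒᵖ) (X : ModuleCat.{u} S) : Type u := X →ₗ[k] Shrink.{u} k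

variable (φ : R ≃ₐ[k] Sᵐᵒᵖ)

instance (X : ModuleCat.{u} S) : AddCommGroup (DualSpace φ X) :=
  inferInstanceAs (AddCommGroup (X →ₗ[k] Shrink.{u} k))

instance (X : ModuleCat.{u} S) : Module k (DualSpace φ X) :=
  inferInstanceAs (Module k (X →ₗ[k] Shrink.{u} k))

instance (X : ModuleCat.{u} S) : FunLike (DualSpace φ X) X (Shrink.{u} k) :=
  inferInstanceAs (FunLike (X →ₗ[k] Shrink.{u} k) X (Shrink.{u} k))

instance (X : ModuleCat.{u} S) : LinearMapClass (DualSpace φ X) k X (Shrink.{u} k) :=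
  inferInstanceAs (LinearMapClass (X →ₗ[k] Shrink.{u} k) k X (Shrink.{u} k))

instance (X : ModuleCat.{u} S) : Module R (DualSpace φ X) where
  smul r f := LinearMap.comp (f : X →ₗ[k] Shrink.{u} k) (Algebra.lsmul k k X (unop (φ r)))
  one_smul f := LinearMap.ext fun x => congrArg f (by simp)
  mul_smul r s f := LinearMap.ext fun x => congrArg f (by simp)
  smul_zero r := rfl
  smul_add r f g := rfl
  add_smul r s f := LinearMap.ext fun x => by
    refine (congrArg f ?_).trans (map_add f (unop (φ r) • x) (unop (φ s) • x))
    simp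
  zero_smul f := LinearMap.ext fun x => by
    refine (congrArg f ?_).trans (map_zero f)
    simp

theorem DualSpace.ext {X : ModuleCat.{u} S} {f g : DualSpace φ X} (h : ∀ x, f x = g x) : f = g :=
  LinearMap.ext h

instance (X : ModuleCat.{u} S) : IsScalarTower k R (DualSpace φ X) where
  smul_assoc c r f := DualSpace.ext φ fun x => by
    change f (unop (φ (c • r)) • x) = c • f (unop (φ r) • x)
    rw [← map_smul, map_smul φ, unop_smul, smul_assoc]

/-- The dual of a module, with the transposed action. -/
def dualModule (X : ModuleCat.{u} S) : ModuleCat.{u} R := ModuleCat.of R (DualSpace φ X)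

/-- The dual space, up to the choice of a one-dimensional target. -/
def DualSpace.equivDual (X : ModuleCat.{u} S) : DualSpace φ X ≃ₗ[k] Module.Dual k X :=
  LinearEquiv.congrRight (M := X) (Shrink.linearEquiv.{u} k k)

instance finite_dualSpace (X : ModuleCat.{u} S) [Module.Finite k X] :
    Module.Finite k (DualSpace φ X) :=
  Module.Finite.equiv (DualSpace.equivDual φ X).symm

instance finite_dualModule (X : ModuleCat.{u} S) [Module.Finite k X] :
    Module.Finite k (dualModule φ X) :=
  finite_moduleCat_of (DualSpace φ X)

/-- The transpose of a morphism. -/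
def dualMap {X Y : ModuleCat.{u} S} (f : X ⟶ Y) : dualModule φ Y ⟶ dualModule φ X :=
  ModuleCat.ofHom (X := DualSpace φ Y) (Y := DualSpace φ X)
    { toFun g := LinearMap.comp (g : Y →ₗ[k] Shrink.{u} k) (f.hom.restrictScalars k)
      map_add' _ _ := rfl
      map_smul' r g := DualSpace.ext φ fun x => by
        change g (unop (φ r) • f.hom x) = g (f.hom (unop (φ r) • x))
        rw [map_smul f.hom] }

theorem dualMap_shortExact {T : ShortComplex (ModuleCat.{u} S)} (hT : T.ShortExact) :
    ∃ w, (ShortComplex.mk (dualMap φ T.g) (dualMap φ T.f) w).ShortExact := by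
  have hex := (ShortComplex.ShortExact.moduleCat_exact_iff_function_exact _).mp hT.exact
  refine ⟨_, shortExact_mk_of_exact (f := (dualMap φ T.g).hom) (g := (dualMap φ T.f).hom)
    (fun a b hab => ?_) (fun a => ?_) fun a => ⟨fun ha => ?_, ?_⟩⟩
  · refine DualSpace.ext φ fun x => ?_
    obtain ⟨y, rfl⟩ := hT.moduleCat_surjective_g x
    exact LinearMap.congr_fun hab y
  -- A `k`-linear retraction extends functionals from the submodule; below, a `k`-linear section
  -- descends functionals to the quotient.
  · obtain ⟨p, hp⟩ := LinearMap.exists_leftInverse_of_injective (T.f.hom.restrictScalars k)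
      (LinearMap.ker_eq_bot.mpr hT.moduleCat_injective_f)
    let a' : T.X₁ →ₗ[k] Shrink.{u} k := a
    refine ⟨LinearMap.comp a' p, DualSpace.ext φ fun x => ?_⟩
    exact congrArg a' (LinearMap.congr_fun hp x)
  · obtain ⟨s, hs⟩ := LinearMap.exists_rightInverse_of_surjective (T.g.hom.restrictScalars k)
      (LinearMap.range_eq_top.mpr hT.moduleCat_surjective_g)
    let a' : T.X₂ →ₗ[k] Shrink.{u} k := a
    refine ⟨LinearMap.comp a' s, DualSpace.ext φ fun x => ?_⟩
    have h1 : T.g.hom (s (T.g.hom x) - x) = 0 := by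
      rw [map_sub, sub_eq_zero]
      exact LinearMap.congr_fun hs (T.g.hom x)
    obtain ⟨y, hy⟩ := (hex _).mp h1
    have h2 : a' (s (T.g.hom x) - x) = 0 := by
      rw [← hy]
      exact LinearMap.congr_fun ha y
    rw [map_sub, sub_eq_zero] at h2
    exact h2
  · rintro ⟨b, rfl⟩
    refine DualSpace.ext φ fun x => ?_
    let b' : T.X₃ →ₗ[k] Shrink.{u} k := b
    exact (congrArg b' (hex.apply_apply_eq_zero x)).trans (map_zero b')

variable (S) in
/-- The regular left module. -/
def regularModule : ModuleCat.{u} S := ModuleCat.of S S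

/-- The dual of the regular module is injective. -/
theorem injective_dualModule_self : Injective (dualModule φ (regularModule S)) where
  factors {Y Z} g m hm := by
    let m' : Y →ₗ[k] Z := m.hom.restrictScalars k
    obtain ⟨p, hp⟩ := LinearMap.exists_leftInverse_of_injective m'
      (LinearMap.ker_eq_bot.mpr ((ModuleCat.mono_iff_injective m).mp hm))
    let G : Y →ₗ[R] DualSpace φ (regularModule S) := g.hom
    -- Maps from `Y` to the dual of the regular module correspond to functionals on `Y`, by
    -- evaluation at 1. The functional `lam` extends to `Z` along the linear retraction `p`, and `H`
    -- is the map that corresponds to the extension.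
    let lam : Y →ₗ[k] Shrink.{u} k :=
      { toFun y := G y (1 : S)
        map_add' y z := by rw [map_add]; rfl
        map_smul' c y := by
          rw [← algebraMap_smul R c y, map_smul, algebraMap_smul]; rfl }
    have hG : ∀ y (s : S), G y s = lam (φ.symm (op s) • y) := fun y s => by
      change G y s = G (φ.symm (op s) • y) (1 : S)
      rw [map_smul]
      refine congrArg (G y) (?_ : s = unop (φ (φ.symm (op s))) * 1)
      rw [φ.apply_symm_apply, unop_op]
      exact (mul_one s).symm
    let act (z : Z) : regularModule S →ₗ[k] Z :=
      { toFun s := φ.symm (op (s : S)) • z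
        map_add' s t := by
          rw [← add_smul, ← map_add]; rfl
        map_smul' c s := by
          have : (c • s : regularModule S) = (c • (show S from s) : S) :=
            algebraMap_smul S c (show S from s)
          rw [this, op_smul, map_smul, smul_assoc]; rfl }
    let H : Z →ₗ[R] DualSpace φ (regularModule S) :=
      { toFun z := lam ∘ₗ p ∘ₗ act z
        map_add' z w := DualSpace.ext φ fun s => by
          refine Eq.trans (congrArg lam (congrArg p (smul_add _ _ _))) ?_
          rw [map_add, map_add]; rfl
        map_smul' r z := DualSpace.ext φ fun s => by
          change lam (p (φ.symm (op (s : S)) • r • z)) =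
            lam (p (φ.symm (op (unop (φ r) * (show S from s))) • z))
          rw [op_mul, op_unop, map_mul, φ.symm_apply_apply, mul_smul] }
    refine ⟨ModuleCat.ofHom H, ?_⟩
    ext y
    refine DualSpace.ext φ fun s => Eq.trans ?_ (hG y s).symm
    change lam (p (φ.symm (op (s : S)) • m.hom y)) = _
    rw [← map_smul]
    exact congrArg lam (LinearMap.congr_fun hp _)

/-- Duality is exact and sends the regular module to an injective one, so it turns projective
resolutions into injective coresolutions. -/
theorem hasInjectiveDimensionLE_dualModule [Module.Finite k S] (d : ℕ) (X : ModuleCat.{u} S)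
    [Module.Finite k X] (hX : HasProjectiveDimensionLE X d) :
    HasInjectiveDimensionLE (dualModule φ X) d := by
  refine projectiveDimension_induction k
    (Q := fun n X => HasInjectiveDimensionLE (dualModule φ X) n)
    (fun X hX => ?_) ?_ (fun T hT h₁ h₃ => ?_) (fun X Y h hY => ?_) (fun n T hT h₁ h₂ => ?_) d X hX
  · have : Subsingleton (dualModule φ X) := ⟨fun f g => DualSpace.ext φ fun x => by
      rw [Subsingleton.elim x 0]
      exact (map_zero (show DualSpace φ X from f)).trans
        (map_zero (show DualSpace φ X from g)).symm⟩
    have := (ModuleCat.isZero_of_subsingleton (dualModule φ X)).hasInjectiveDimensionLT_zero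
    exact hasInjectiveDimensionLT_of_ge _ 0 _ (Nat.zero_le _)
  · have := injective_dualModule_self φ
    exact inferInstanceAs (HasInjectiveDimensionLT (dualModule φ (regularModule S)) 1)
  · obtain ⟨w, h⟩ := dualMap_shortExact φ hT
    exact h.hasInjectiveDimensionLT_X₂ _ h₃ h₁
  · have r : Retract (dualModule φ X) (dualModule φ Y) :=
      ⟨dualMap φ h.r, dualMap φ h.i, by
        ext f
        refine DualSpace.ext φ fun x => ?_
        let f' : X →ₗ[k] Shrink.{u} k := f
        exact congrArg f' (congrArg (fun t => t.hom x) h.retract)⟩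
    exact r.hasInjectiveDimensionLT 1
  · obtain ⟨w, h⟩ := dualMap_shortExact φ hT
    exact h.hasInjectiveDimensionLT_X₁ _ h₁ (hasInjectiveDimensionLT_of_ge _ 1 _ (by omega))

/-- The action on the dual is the transposed action, and transposes have equal rank. -/
theorem dimAt_dualModule (r : R) (X : ModuleCat.{u} S) [Module.Finite k X] :
    dimAt k r (dualModule φ X) = dimAt k (unop (φ r)) X := by
  let ψ : dualModule φ X →ₗ[k] Module.Dual k X :=
    { toFun f := DualSpace.equivDual φ X f
      map_add' _ _ := map_add (DualSpace.equivDual φ X) _ _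
      map_smul' c f := (congrArg (DualSpace.equivDual φ X) (algebraMap_smul R c
        (show DualSpace φ X from f))).trans
          (map_smul (DualSpace.equivDual φ X) c (show DualSpace φ X from f)) }
  have hψ : Function.Injective ψ := (DualSpace.equivDual φ X).injective
  have key : Submodule.map ψ (LinearMap.range (Algebra.lsmul k k (dualModule φ X) r)) =
      LinearMap.range (Algebra.lsmul k k X (unop (φ r)) : X →ₗ[k] X).dualMap := by
    ext y
    constructor
    · rintro ⟨_, ⟨f, rfl⟩, rfl⟩
      exact ⟨ψ f, rfl⟩
    · rintro ⟨f, rfl⟩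
      obtain ⟨f, rfl⟩ := (DualSpace.equivDual φ X).surjective f
      exact ⟨_, ⟨f, rfl⟩, rfl⟩
  rw [dimAt, LinearEquiv.finrank_eq (Submodule.equivMapOfInjective ψ hψ _), key,
    LinearMap.finrank_range_dualMap_eq_finrank_range]
  rfl

theorem dualModule_simpleModule (χ : R →ₐ[k] k) :
    Nonempty (simpleModule χ ≅ dualModule φ (simpleModule (oppositeCharacter φ χ))) := by
  set X := simpleModule (oppositeCharacter φ χ)
  refine simpleModule.nonempty_iso χ _ ?_ fun r f => DualSpace.ext φ fun x => ?_
  · have : Module.Finite k X :=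
      Module.finite_of_finrank_eq_succ (simpleModule.finrank_eq_one _)
    have h := dimAt_dualModule φ (1 : R) X
    have h1 (Y : ModuleCat.{u} R) : dimAt k (1 : R) Y = Module.finrank k Y := by
      rw [dimAt, map_one, Module.End.one_eq_id, LinearMap.range_id, finrank_top]
    rw [← h1, h, map_one, dimAt, unop_one, map_one, Module.End.one_eq_id, LinearMap.range_id,
      finrank_top, simpleModule.finrank_eq_one]
  · let f' : X →ₗ[k] Shrink.{u} k := f
    have h1 : (χ r • f : dualModule φ X) = (χ r • f' : X →ₗ[k] Shrink.{u} k) :=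
      algebraMap_smul R (χ r) (show DualSpace φ X from f)
    rw [h1]
    change f' (unop (φ r) • x) = χ r • f' x
    rw [simpleModule.smul_eq, oppositeCharacter_apply, map_smul]

/-- Finiteness of the global dimension passes to the opposite algebra. -/
theorem HasFiniteModGldim.opposite (φ : R ≃ₐ[k] Sᵐᵒᵖ) [Module.Finite k R] [Module.Finite k S]
    (hS : HasFiniteModGldim k S) {ι : Type} {χ : ι → R →ₐ[k] k} (hχ : HasEigenvectors χ) :
    HasFiniteModGldim k R := by
  obtain ⟨d, hd⟩ := hS
  refine ⟨d + 1, fun M hM => hasProjectiveDimensionLE_of_ext_eq_zero (k := k) d M fun N hN => ?_⟩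
  -- The simple `R`-modules are duals of simple `S`-modules, so their injective dimension is
  -- bounded, and composition series carry the bound to `N`.
  have : HasInjectiveDimensionLT N (d + 1) := by
    refine hχ.hasInjectiveDimensionLT (fun i => ?_) N
    obtain ⟨e⟩ := dualModule_simpleModule φ (χ i)
    have := hd (simpleModule (oppositeCharacter φ (χ i))) inferInstance
    have := hasInjectiveDimensionLE_dualModule φ d (simpleModule (oppositeCharacter φ (χ i)))
      (hasProjectiveDimensionLT_of_ge _ d _ (by omega))
    exact hasInjectiveDimensionLT_of_iso e.symm _
  exact HasInjectiveDimensionLT.subsingleton N (d + 1) (d + 1) le_rfl M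

end Duality

/-! ### Tensor products of algebras -/

section Tensor

open Abelian
open scoped ModuleCat

variable {k : Type v} [Field k] {B C R : Type u} [Ring B] [Algebra k B] [Ring C] [Algebra k C]
  [Ring R]

/-- The change of rings bound `pd_R X ≤ pd_R B + pd_B X`, by induction on the second term, as
restriction of scalars is exact. -/
theorem hasProjectiveDimensionLT_restrictScalars [Module.Finite k B] (ψ : R →+* B) (c : ℕ)
    (hB : HasProjectiveDimensionLT ((ModuleCat.restrictScalars ψ).obj (ModuleCat.of B B)) (c + 1))
    (d : ℕ) (X : ModuleCat.{u} B) [Module.Finite k X] (hX : HasProjectiveDimensionLE X d) :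
    HasProjectiveDimensionLT ((ModuleCat.restrictScalars ψ).obj X) (c + 1 + d) := by
  have hses : ∀ T : ShortComplex (ModuleCat.{u} B), T.ShortExact →
      (T.map (ModuleCat.restrictScalars ψ)).ShortExact := fun T hT =>
    shortExact_mk_of_exact (f := ((ModuleCat.restrictScalars ψ).map T.f).hom)
      (g := ((ModuleCat.restrictScalars ψ).map T.g).hom) hT.moduleCat_injective_f
      hT.moduleCat_surjective_g
      ((ShortComplex.ShortExact.moduleCat_exact_iff_function_exact _).mp hT.exact)
  refine projectiveDimension_induction k (Q := fun n X => HasProjectiveDimensionLT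
    ((ModuleCat.restrictScalars ψ).obj X) (c + 1 + n)) (fun X hX => ?_) hB
    (fun T hT h₁ h₃ => (hses T hT).hasProjectiveDimensionLT_X₂ _ h₁ h₃)
    (fun X Y h hY => (h.map (ModuleCat.restrictScalars ψ)).hasProjectiveDimensionLT _)
    (fun n T hT h₁ h₂ => (hses T hT).hasProjectiveDimensionLT_X₃ (c + 1 + n) h₁ ?_) d X hX
  swap
  · have : HasProjectiveDimensionLT (T.map (ModuleCat.restrictScalars ψ)).X₂ (c + 1) := h₂
    exact hasProjectiveDimensionLT_of_ge _ (c + 1) _ (by omega)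
  have : Subsingleton ((ModuleCat.restrictScalars ψ).obj X) := hX
  have := (ModuleCat.isZero_of_subsingleton
    ((ModuleCat.restrictScalars ψ).obj X)).hasProjectiveDimensionLT_zero
  exact hasProjectiveDimensionLT_of_ge _ 0 _ (Nat.zero_le _)

/-- Restriction of scalars along an algebra map does not change the underlying vector space. -/
def restrictScalarsEquiv [Algebra k R] (ψ : R →ₐ[k] B) (X : ModuleCat.{u} B) :
    (ModuleCat.restrictScalars ψ.toRingHom).obj X ≃ₗ[k] X where
  toFun x := x
  invFun x := x
  map_add' _ _ := rfl
  map_smul' c x := by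
    change ψ (algebraMap k R c) • (show X from x) = c • (show X from x)
    rw [AlgHom.commutes, algebraMap_smul]

variable (k B) in
/-- The underlying space of the module induced from `C` to `B ⊗ C`. -/
def TensorSpace (Y : ModuleCat.{u} C) : Type u := B ⊗[k] Y

instance (Y : ModuleCat.{u} C) : AddCommGroup (TensorSpace k B Y) :=
  inferInstanceAs (AddCommGroup (B ⊗[k] Y))

variable (k B) in
/-- The action of `B ⊗ C` on `B ⊗ Y`. -/
def tensorAction (Y : ModuleCat.{u} C) : B ⊗[k] C →ₐ[k] Module.End k (B ⊗[k] Y) :=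
  Module.endTensorEndAlgHom.comp
    (Algebra.TensorProduct.map (Algebra.lmul k B) (Algebra.lsmul k k Y))

theorem tensorAction_tmul (Y : ModuleCat.{u} C) (b b' : B) (c : C) (y : Y) :
    tensorAction k B Y (b ⊗ₜ c) (b' ⊗ₜ y) = (b * b') ⊗ₜ (c • y) := by
  rw [tensorAction, AlgHom.comp_apply, Algebra.TensorProduct.map_tmul,
    Module.endTensorEndAlgHom_apply]
  rfl

instance (Y : ModuleCat.{u} C) : Module (B ⊗[k] C) (TensorSpace k B Y) :=
  Module.compHom (B ⊗[k] Y) (tensorAction k B Y).toRingHom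

variable (k B) in
/-- The `B ⊗ C`-module `B ⊗ Y`. -/
def inducedModule (Y : ModuleCat.{u} C) : ModuleCat.{u} (B ⊗[k] C) :=
  ModuleCat.of (B ⊗[k] C) (TensorSpace k B Y)

theorem lTensor_tensorAction {Y Z : ModuleCat.{u} C} (f : Y ⟶ Z) (r : B ⊗[k] C) (x : B ⊗[k] Y) :
    (f.hom.restrictScalars k).lTensor B (tensorAction k B Y r x) =
      tensorAction k B Z r ((f.hom.restrictScalars k).lTensor B x) := by
  induction r with
  | zero => simp
  | add r s hr hs => simp [hr, hs]
  | tmul b c =>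
    induction x with
    | zero => simp
    | add x y hx hy => simp only [map_add, hx, hy]
    | tmul b' y => simp [tensorAction_tmul]

/-- Functoriality of the induced module. -/
def inducedMap {Y Z : ModuleCat.{u} C} (f : Y ⟶ Z) : inducedModule k B Y ⟶ inducedModule k B Z :=
  ModuleCat.ofHom (X := TensorSpace k B Y) (Y := TensorSpace k B Z)
    { toFun := (f.hom.restrictScalars k).lTensor B
      map_add' := map_add ((f.hom.restrictScalars k).lTensor B)
      map_smul' := lTensor_tensorAction f }

theorem inducedMap_shortExact {T : ShortComplex (ModuleCat.{u} C)} (hT : T.ShortExact) :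
    ∃ w, (ShortComplex.mk (inducedMap (k := k) (B := B) T.f) (inducedMap T.g) w).ShortExact :=
  ⟨_, shortExact_mk_of_exact (f := (inducedMap (k := k) (B := B) T.f).hom)
    (g := (inducedMap (k := k) (B := B) T.g).hom)
    (Module.Flat.lTensor_preserves_injective_linearMap (T.f.hom.restrictScalars k)
      hT.moduleCat_injective_f)
    (LinearMap.lTensor_surjective B (g := T.g.hom.restrictScalars k) hT.moduleCat_surjective_g)
    (lTensor_exact B (f := T.f.hom.restrictScalars k) (g := T.g.hom.restrictScalars k)
      ((ShortComplex.ShortExact.moduleCat_exact_iff_function_exact _).mp hT.exact)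
      hT.moduleCat_surjective_g)⟩

theorem projective_inducedModule_self :
    Projective (inducedModule k B (regularModule C)) := by
  let κ : C ≃ₗ[k] regularModule C :=
    { (LinearEquiv.refl C C : C ≃ₗ[C] regularModule C) with
      map_smul' c x := (algebraMap_smul C c x).symm }
  let f : B ⊗[k] C ≃ₗ[k] B ⊗[k] regularModule C :=
    TensorProduct.congr (LinearEquiv.refl k B) κ
  have hf : ∀ r x : B ⊗[k] C, f (r * x) = tensorAction k B (regularModule C) r (f x) := by
    intro r x
    induction r with
    | zero => simp
    | add r s hr hs => simp only [map_add, add_mul, hr, hs, LinearMap.add_apply]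
    | tmul b c =>
      induction x with
      | zero => simp
      | add x y hx hy => simp only [map_add, mul_add, hx, hy]
      | tmul b' c' =>
        rw [Algebra.TensorProduct.tmul_mul_tmul, TensorProduct.congr_tmul,
          TensorProduct.congr_tmul, tensorAction_tmul]
        rfl
  let F : (B ⊗[k] C) ≃ₗ[B ⊗[k] C] TensorSpace k B (regularModule C) :=
    { toFun := f
      invFun := f.symm
      left_inv := f.left_inv
      right_inv := f.right_inv
      map_add' := map_add f
      map_smul' := hf }
  exact (IsProjective.iff_projective (TensorSpace k B (regularModule C))).mp
    (Module.Projective.of_equiv F)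

/-- The functor `B ⊗ -` is exact over a field and sends `C` to the regular module of `B ⊗ C`. -/
theorem hasProjectiveDimensionLE_inducedModule [Module.Finite k C] (d : ℕ) (Y : ModuleCat.{u} C)
    [Module.Finite k Y] (hY : HasProjectiveDimensionLE Y d) :
    HasProjectiveDimensionLE (inducedModule k B Y) d := by
  refine projectiveDimension_induction k (Q := fun n Y => HasProjectiveDimensionLE
    (inducedModule k B Y) n) (fun X hX => ?_) ?_ (fun T hT h₁ h₃ => ?_)
    (fun X Y h hY => ?_) (fun n T hT h₁ h₂ => ?_) d Y hY
  · have : Subsingleton (inducedModule k B X) := inferInstanceAs (Subsingleton (B ⊗[k] X))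
    have := (ModuleCat.isZero_of_subsingleton
      (inducedModule k B X)).hasProjectiveDimensionLT_zero
    exact hasProjectiveDimensionLT_of_ge _ 0 _ (Nat.zero_le _)
  · have := projective_inducedModule_self (k := k) (B := B) (C := C)
    exact inferInstanceAs (HasProjectiveDimensionLT (inducedModule k B (regularModule C)) 1)
  · obtain ⟨w, h⟩ := inducedMap_shortExact (k := k) (B := B) hT
    exact h.hasProjectiveDimensionLT_X₂ _ h₁ h₃
  · have r : Retract (inducedModule k B X) (inducedModule k B Y) :=
      ⟨inducedMap h.i, inducedMap h.r, by
        ext x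
        refine Eq.trans (LinearMap.lTensor_comp_apply B (h.r.hom.restrictScalars k)
          (h.i.hom.restrictScalars k) (show B ⊗[k] X from x)).symm ?_
        have : h.r.hom.restrictScalars k ∘ₗ h.i.hom.restrictScalars k = LinearMap.id :=
          LinearMap.ext fun y => congrArg (fun t => t.hom y) h.retract
        rw [this, LinearMap.lTensor_id]
        rfl⟩
    exact r.hasProjectiveDimensionLT 1
  · obtain ⟨w, h⟩ := inducedMap_shortExact (k := k) (B := B) hT
    exact h.hasProjectiveDimensionLT_X₃ _ h₁ (hasProjectiveDimensionLT_of_ge _ 1 _ (by omega))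

variable (B) in
/-- The algebra map `B ⊗ C → B` induced by a character of `C`. -/
def evalRight (χ : C →ₐ[k] k) : B ⊗[k] C →ₐ[k] B :=
  Algebra.TensorProduct.lift (AlgHom.id k B) ((Algebra.ofId k B).comp χ)
    fun b c => (show Commute b (algebraMap k B (χ c)) from (Algebra.commutes (χ c) b).symm)

theorem evalRight_tmul (χ : C →ₐ[k] k) (b : B) (c : C) :
    evalRight B χ (b ⊗ₜ c) = χ c • b := by
  refine (Algebra.TensorProduct.lift_tmul _ _ _ _ _).trans ?_
  rw [Algebra.smul_def, Algebra.commutes]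
  rfl

/-- The map `b ↦ b ⊗ gen` is surjective between spaces of equal dimension. -/
theorem inducedModule_simpleModule [Module.Finite k B] (χ : C →ₐ[k] k) :
    Nonempty (inducedModule k B (simpleModule χ) ≅
      (ModuleCat.restrictScalars (evalRight B χ).toRingHom).obj (ModuleCat.of B B)) := by
  let f : B →ₗ[k] B ⊗[k] simpleModule χ := (TensorProduct.mk k B _).flip (simpleModule.gen χ)
  have hsurj : Function.Surjective f := fun x => by
    induction x with
    | zero => exact ⟨0, map_zero f⟩
    | add x y hx hy =>
      obtain ⟨a, rfl⟩ := hx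
      obtain ⟨b, rfl⟩ := hy
      exact ⟨a + b, map_add f a b⟩
    | tmul b y =>
      obtain ⟨c, rfl⟩ := simpleModule.exists_smul_gen χ y
      exact ⟨χ c • b, by simp [f, simpleModule.smul_gen, TensorProduct.smul_tmul']⟩
  have : Module.Finite k (simpleModule χ) :=
    Module.finite_of_finrank_eq_succ (simpleModule.finrank_eq_one _)
  have hinj : Function.Injective f := (LinearMap.injective_iff_surjective_of_finrank_eq_finrank
    (by rw [Module.finrank_tensorProduct, simpleModule.finrank_eq_one, mul_one])).mpr hsurj
  have hf : ∀ (r : B ⊗[k] C) (b : B),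
      f (evalRight B χ r * b) = tensorAction k B (simpleModule χ) r (f b) := fun r b => by
    induction r with
    | zero => simp
    | add r s hr hs => simp only [map_add, add_mul, hr, hs, LinearMap.add_apply]
    | tmul b' c =>
      simp [f, evalRight_tmul, tensorAction_tmul, simpleModule.smul_gen]
  let F : (ModuleCat.restrictScalars (evalRight B χ).toRingHom).obj (ModuleCat.of B B) →ₗ[B ⊗[k] C]
      TensorSpace k B (simpleModule χ) :=
    { toFun := f
      map_add' := map_add f
      map_smul' := hf }
  exact ⟨(LinearEquiv.ofBijective F ⟨hinj, hsurj⟩).toModuleIso.symm⟩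

/-- The product of two characters. -/
def productCharacter (χ : B →ₐ[k] k) (χ' : C →ₐ[k] k) : B ⊗[k] C →ₐ[k] k :=
  Algebra.TensorProduct.lift χ χ' fun _ _ => Commute.all _ _

theorem productCharacter_tmul (χ : B →ₐ[k] k) (χ' : C →ₐ[k] k) (b : B) (c : C) :
    productCharacter χ χ' (b ⊗ₜ c) = χ b * χ' c := by
  simp [productCharacter]

theorem productCharacter_apply (χ : B →ₐ[k] k) (χ' : C →ₐ[k] k) (r : B ⊗[k] C) :
    productCharacter χ χ' r = χ (evalRight B χ' r) := by
  induction r with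
  | zero => simp
  | add r s hr hs => simp only [map_add, hr, hs]
  | tmul b c => simp [productCharacter_tmul, evalRight_tmul, mul_comm]

theorem restrictScalars_simpleModule (χ : B →ₐ[k] k) (χ' : C →ₐ[k] k) :
    Nonempty (simpleModule (productCharacter χ χ') ≅
      (ModuleCat.restrictScalars (evalRight B χ').toRingHom).obj (simpleModule χ)) := by
  refine simpleModule.nonempty_iso _ _ ?_ fun r m => ?_
  · rw [← simpleModule.finrank_eq_one χ]
    exact (restrictScalarsEquiv (evalRight B χ') _).finrank_eq
  · change evalRight B χ' r • (show simpleModule χ from m) = evalRight B χ'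
      (algebraMap k _ (productCharacter χ χ' r)) • (show simpleModule χ from m)
    rw [AlgHom.commutes, algebraMap_smul, productCharacter_apply, simpleModule.smul_eq]

/-- Over `B ⊗ C`, the module `B` is induced from the simple module of `χ'`, which bounds its
projective dimension. The simple module of the product character is restricted from `B`, so the
change of rings bound applies. -/
theorem exists_hasProjectiveDimensionLT_productCharacter [Module.Finite k B] [Module.Finite k C]
    (hB : HasFiniteModGldim k B) (hC : HasFiniteModGldim k C) (χ : B →ₐ[k] k) (χ' : C →ₐ[k] k) :
    ∃ d, HasProjectiveDimensionLT (simpleModule (productCharacter χ χ')) d := by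
  obtain ⟨b, hb⟩ := hB
  obtain ⟨c, hc⟩ := hC
  obtain ⟨i₁⟩ := inducedModule_simpleModule (B := B) χ'
  obtain ⟨i₂⟩ := restrictScalars_simpleModule χ χ'
  have := hb (simpleModule χ) inferInstance
  have := hc (simpleModule χ') inferInstance
  have := hasProjectiveDimensionLE_inducedModule (k := k) (B := B) c (simpleModule χ')
    (hasProjectiveDimensionLT_of_ge _ c _ (by omega))
  have := hasProjectiveDimensionLT_restrictScalars (k := k) (evalRight B χ').toRingHom c
    (hasProjectiveDimensionLT_of_iso i₁ (c + 1)) b (simpleModule χ)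
    (hasProjectiveDimensionLT_of_ge _ b _ (by omega))
  exact ⟨c + 1 + b, hasProjectiveDimensionLT_of_iso i₂.symm _⟩

end Tensor

/-! ### Eigenvectors for tensor products -/

section Eigenvectors

open scoped ModuleCat

variable {k : Type v} [Field k] {B C R : Type u} [Ring B] [Algebra k B] [Ring C] [Algebra k C]
  [Ring R] [Algebra k R] {ι κ : Type}

theorem HasEigenvectors.of_surjective (g : R →ₐ[k] B) (hg : Function.Surjective g)
    {χ : ι → B →ₐ[k] k} (h : HasEigenvectors fun i => (χ i).comp g) : HasEigenvectors χ := by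
  intro M _ hM
  have : Module.Finite k ((ModuleCat.restrictScalars g.toRingHom).obj M) :=
    Module.Finite.equiv (restrictScalarsEquiv g M).symm
  have : Nontrivial ((ModuleCat.restrictScalars g.toRingHom).obj M) := hM
  obtain ⟨i, v, hv, hr⟩ := h ((ModuleCat.restrictScalars g.toRingHom).obj M)
  refine ⟨i, restrictScalarsEquiv g M v, hv, fun b => ?_⟩
  obtain ⟨r, rfl⟩ := hg b
  exact (congrArg (restrictScalarsEquiv g M) (hr r)).trans
    (map_smul (restrictScalarsEquiv g M) _ v)

/-- The actions of `B` and `C` commute, so a nonzero eigenspace `V` of `B` is a `C`-module and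
contains an eigenvector of `C`. -/
theorem HasEigenvectors.tensor {χ : ι → B →ₐ[k] k} {χ' : κ → C →ₐ[k] k}
    (hB : HasEigenvectors χ) (hC : HasEigenvectors χ') :
    HasEigenvectors fun p : ι × κ => productCharacter (χ p.1) (χ' p.2) := by
  intro M _ hM
  let f : B →ₐ[k] B ⊗[k] C := Algebra.TensorProduct.includeLeft
  let g : C →ₐ[k] B ⊗[k] C := Algebra.TensorProduct.includeRight
  have hfg : ∀ b c, f b * g c = b ⊗ₜ c := fun b c => by simp [f, g]
  have hgf : ∀ b c, g c * f b = b ⊗ₜ c := fun b c => by simp [f, g]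
  have : Module.Finite k ((ModuleCat.restrictScalars f.toRingHom).obj M) :=
    Module.Finite.equiv (restrictScalarsEquiv f M).symm
  have : Nontrivial ((ModuleCat.restrictScalars f.toRingHom).obj M) := hM
  obtain ⟨i, v, hv, hr⟩ := hB ((ModuleCat.restrictScalars f.toRingHom).obj M)
  have hv' : ∀ b, f b • (restrictScalarsEquiv f M v) = χ i b • restrictScalarsEquiv f M v :=
    fun b => (congrArg (restrictScalarsEquiv f M) (hr b)).trans
      (map_smul (restrictScalarsEquiv f M) _ v)
  let N := (ModuleCat.restrictScalars g.toRingHom).obj M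
  have : Module.Finite k N := Module.Finite.equiv (restrictScalarsEquiv g M).symm
  let V : Submodule C N :=
    { carrier := {w | ∀ b, f b • (restrictScalarsEquiv g M w) = χ i b • restrictScalarsEquiv g M w}
      add_mem' := fun {x y} hx hy b => by
        rw [map_add, smul_add, smul_add, hx b, hy b]
      zero_mem' := fun b => by
        rw [map_zero, smul_zero, smul_zero]
      smul_mem' := fun c x hx b => by
        change f b • g c • restrictScalarsEquiv g M x = χ i b • g c • restrictScalarsEquiv g M x
        rw [← mul_smul, hfg, ← hgf, mul_smul, hx b, smul_comm] }
  have : Module.Finite k (ModuleCat.of C V) :=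
    Module.Finite.of_injective (V.subtype.restrictScalars k) V.subtype_injective
  have : Nontrivial (ModuleCat.of C V) :=
    ⟨⟨⟨v, hv'⟩, 0, fun h => hv (congrArg Subtype.val h)⟩⟩
  obtain ⟨j, w, hw, hs⟩ := hC (ModuleCat.of C V)
  have hw' : ∀ c, g c • (restrictScalarsEquiv g M w.1) = χ' j c • restrictScalarsEquiv g M w.1 :=
    fun c => (congrArg (fun t : V => restrictScalarsEquiv g M t.1) (hs c)).trans
      (map_smul (restrictScalarsEquiv g M) (χ' j c) w.1)
  refine ⟨(i, j), restrictScalarsEquiv g M w.1, fun h => hw (Subtype.ext h), fun r => ?_⟩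
  induction r with
  | zero => simp
  | add r s hr hs => rw [add_smul, hr, hs, map_add, add_smul]
  | tmul b c => rw [← hfg, mul_smul, hw', smul_comm, w.2 b, hfg, productCharacter_tmul,
      smul_smul, mul_comm]

variable [Fintype ι] [Fintype κ]

theorem IsSplitBasic.tensor {e : ι → B} {χ : ι → B →ₐ[k] k} {e' : κ → C} {χ' : κ → C →ₐ[k] k}
    (hB : IsSplitBasic e χ) (hC : IsSplitBasic e' χ') :
    IsSplitBasic (fun p : ι × κ => e p.1 ⊗ₜ[k] e' p.2)
      (fun p : ι × κ => productCharacter (χ p.1) (χ' p.2)) where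
  complete :=
    { idem p := by
        rw [IsIdempotentElem, Algebra.TensorProduct.tmul_mul_tmul, (hB.complete.idem p.1).eq,
          (hC.complete.idem p.2).eq]
      ortho p q hpq := by
        change (e p.1 ⊗ₜ[k] e' p.2) * (e q.1 ⊗ₜ[k] e' q.2) = 0
        rw [Algebra.TensorProduct.tmul_mul_tmul]
        by_cases h : p.1 = q.1
        · have h2 : p.2 ≠ q.2 := fun h2 => hpq (Prod.ext h h2)
          have : e' p.2 * e' q.2 = 0 := hC.complete.ortho h2
          rw [this, TensorProduct.tmul_zero]
        · have : e p.1 * e q.1 = 0 := hB.complete.ortho h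
          rw [this, TensorProduct.zero_tmul]
      complete := by
        rw [Fintype.sum_prod_type]
        simp_rw [← TensorProduct.tmul_sum, hC.complete.complete, ← TensorProduct.sum_tmul,
          hB.complete.complete]
        rfl }
  apply_same p := by
    rw [productCharacter_tmul, hB.apply_same, hC.apply_same, mul_one]
  apply_ne p q hpq := by
    rw [productCharacter_tmul]
    by_cases h : p.1 = q.1
    · rw [hC.apply_ne _ _ fun h2 => hpq (Prod.ext h h2), mul_zero]
    · rw [hB.apply_ne _ _ h, zero_mul]
  eigen := hB.eigen.tensor hC.eigen

theorem IsSplitBasic.map {e : ι → R} {χ : ι → R →ₐ[k] k} (h : IsSplitBasic e χ) (g : R ≃ₐ[k] B) :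
    IsSplitBasic (fun i => g (e i)) (fun i => (χ i).comp g.symm.toAlgHom) where
  complete := h.complete.map g.toRingEquiv.toRingHom
  apply_same i := by simpa using h.apply_same i
  apply_ne i j hij := by simpa using h.apply_ne i j hij
  eigen := by
    refine HasEigenvectors.of_surjective g.toAlgHom g.surjective ?_
    have : (fun i => ((χ i).comp g.symm.toAlgHom).comp g.toAlgHom) = χ :=
      funext fun i => AlgHom.ext fun r => by simp
    rw [this]
    exact h.eigen

theorem HasFiniteModGldim.tensor [Module.Finite k B] [Module.Finite k C] {χ : ι → B →ₐ[k] k}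
    {χ' : κ → C →ₐ[k] k} (hχ : HasEigenvectors χ) (hχ' : HasEigenvectors χ')
    (hB : HasFiniteModGldim k B) (hC : HasFiniteModGldim k C) :
    HasFiniteModGldim k (B ⊗[k] C) :=
  (hχ.tensor hχ').hasFiniteModGldim fun p =>
    exists_hasProjectiveDimensionLT_productCharacter hB hC (χ p.1) (χ' p.2)

end Eigenvectors

/-! ### Elementary algebras are split basic -/

section Elementary

open scoped ModuleCat

variable {k : Type v} [Field k] {A R : Type u} [Ring A] [Algebra k A] [Ring R] [Algebra k R]
  {ι : Type} [Fintype ι]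

/-- If the common kernel of the characters kills `v`, then some `e i • v` is nonzero, and it is an
eigenvector because `r * e i - χ i r • e i` lies in that kernel. -/
theorem hasEigenvectors_of_annihilated {e : ι → R} {χ : ι → R →ₐ[k] k}
    (he : CompleteOrthogonalIdempotents e) (hs : ∀ i, χ i (e i) = 1)
    (hne : ∀ i j, i ≠ j → χ i (e j) = 0)
    (h : ∀ (M : ModuleCat.{u} R) [Nontrivial M], ∃ v : M, v ≠ 0 ∧
      ∀ x : R, (∀ i, χ i x = 0) → x • v = 0) : HasEigenvectors χ := by
  intro M _ hM
  obtain ⟨v, hv, hx⟩ := h M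
  obtain ⟨i, hi⟩ : ∃ i, e i • v ≠ 0 := by
    by_contra! hc
    apply hv
    rw [← one_smul R v, ← he.complete, Finset.sum_smul]
    exact Finset.sum_eq_zero fun i _ => hc i
  refine ⟨i, e i • v, hi, fun r => ?_⟩
  rw [← sub_eq_zero, ← mul_smul, ← smul_assoc, ← sub_smul]
  refine hx _ fun j => ?_
  rcases eq_or_ne j i with rfl | hj
  · simp [hs]
  · simp [hne j i hj]

/-- Otherwise a nonzero vector could be multiplied by elements of `J` indefinitely without becoming
zero. -/
theorem exists_annihilated_left {J : Ideal A} [J.IsTwoSided] (hJ : IsNilpotent J) (M : Type*) [AddCommGroup M]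
    [Module A M] [Nontrivial M] : ∃ v : M, v ≠ 0 ∧ ∀ x ∈ J, x • v = 0 := by
  by_contra! hc
  obtain ⟨v, hv⟩ := exists_ne (0 : M)
  have key : ∀ n : ℕ, ∃ x ∈ J ^ n, x • v ≠ 0 := fun n => by
    induction n with
    | zero => exact ⟨1, by simp [Submodule.pow_zero], by simpa using hv⟩
    | succ n ih =>
      obtain ⟨x, hx, hxv⟩ := ih
      obtain ⟨y, hy, hyx⟩ := hc _ hxv
      refine ⟨y * x, ?_, by rwa [mul_smul]⟩
      rw [Ideal.IsTwoSided.pow_succ]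
      exact Ideal.mul_mem_mul hy hx
  obtain ⟨n, hn⟩ := hJ
  obtain ⟨x, hx, hxv⟩ := key n
  rw [hn] at hx
  exact hxv (by rw [(Submodule.mem_bot A).mp hx, zero_smul])

theorem exists_annihilated_right {J : Ideal A} [J.IsTwoSided] (hJ : IsNilpotent J) (M : Type*) [AddCommGroup M]
    [Module Aᵐᵒᵖ M] [Nontrivial M] : ∃ v : M, v ≠ 0 ∧ ∀ x ∈ J, op x • v = 0 := by
  by_contra! hc
  obtain ⟨v, hv⟩ := exists_ne (0 : M)
  have key : ∀ n : ℕ, ∃ x ∈ J ^ n, op x • v ≠ 0 := fun n => by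
    induction n with
    | zero => exact ⟨1, by simp [Submodule.pow_zero], by simpa using hv⟩
    | succ n ih =>
      obtain ⟨x, hx, hxv⟩ := ih
      obtain ⟨y, hy, hyx⟩ := hc _ hxv
      refine ⟨x * y, ?_, by rwa [op_mul, mul_smul]⟩
      rw [Submodule.pow_succ]
      exact Ideal.mul_mem_mul hx hy
  obtain ⟨n, hn⟩ := hJ
  obtain ⟨x, hx, hxv⟩ := key n
  rw [hn] at hx
  exact hxv (by rw [(Submodule.mem_bot A).mp hx, op_zero, zero_smul])

/-- Characters dual to a complete set of primitive idempotents of an elementary algebra. -/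
theorem IsElementary.exists_characters [Module.Finite k A] (hA : IsElementary k A) {n : ℕ}
    {e : Fin n → A} (he : IsCompletePrimitive e) :
    ∃ χ : Fin n → A →ₐ[k] k, (∀ i, χ i (e i) = 1) ∧ (∀ i j, i ≠ j → χ i (e j) = 0) ∧
      ∀ x, (∀ i, χ i x = 0) → x ∈ Ring.jacobson A := by
  classical
  obtain ⟨m, ⟨Φ⟩⟩ := hA
  have : IsArtinianRing A := isArtinian_of_tower k inferInstance
  have hnil : IsNilpotent (Ring.jacobson A) := IsSemiprimaryRing.isNilpotent
  let q : A →ₐ[k] (Fin m → k) := Φ.toAlgHom.comp (Ideal.Quotient.mkₐ k (Ring.jacobson A))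
  have hq : Function.Surjective q := Φ.surjective.comp Ideal.Quotient.mk_surjective
  have hker : ∀ x, q x = 0 ↔ x ∈ Ring.jacobson A := fun x => by
    simp [q, Ideal.Quotient.eq_zero_iff_mem]
  have hnil' : ∀ x ∈ RingHom.ker q.toRingHom, IsNilpotent x := fun x hx => by
    obtain ⟨N, hN⟩ := hnil
    refine ⟨N, ?_⟩
    have := Ideal.pow_mem_pow ((hker x).mp hx) N
    rwa [hN] at this
  let π : Fin m → A →ₐ[k] k := fun t => (Pi.evalAlgHom k (fun _ => k) t).comp q
  have hval : ∀ t i, π t (e i) = 0 ∨ π t (e i) = 1 := fun t i =>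
    IsIdempotentElem.iff_eq_zero_or_one.mp ((he.complete.idem i).map (π t))
  have hex : ∀ t, ∃ i, π t (e i) = 1 := fun t => by
    by_contra! hc
    have h1 : π t (∑ i, e i) = 0 := by
      rw [map_sum]
      exact Finset.sum_eq_zero fun i _ => (hval t i).resolve_right (hc i)
    rw [he.complete.complete, map_one] at h1
    exact one_ne_zero h1
  -- Each factor `t` of `A / rad A` sees exactly one idempotent, `e (τ t)`; the aim is that `τ` is a
  -- bijection.
  choose τ hτ using hex
  have hτ' : ∀ t i, i ≠ τ t → π t (e i) = 0 := fun t i hi => by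
    have h1 : e i * e (τ t) = 0 := he.complete.ortho hi
    have := congrArg (π t) h1
    rwa [map_mul, hτ, mul_one, map_zero] at this
  -- An idempotent seen by no factor lies in the radical, so it is nilpotent and therefore zero.
  have hsurj : Function.Surjective τ := fun i => by
    by_contra! hc
    have h0 : q (e i) = 0 := funext fun t => hτ' t i (hc t).symm
    obtain ⟨N, hN⟩ := hnil' (e i) h0
    have hi := (he.primitive i).ne_zero
    rcases N with - | N
    · exact hi (by rw [← mul_one (e i), ← pow_zero (e i), hN, mul_zero])
    · rw [(he.complete.idem i).pow_succ_eq] at hN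
      exact hi hN
  have hinj : Function.Injective τ := fun t s hts => by
    by_contra hne
    -- If two factors saw `e i`, the unit vector of one of them would lift to an idempotent `f`
    -- orthogonal to `1 - e i`, and `e i = f + (e i - f)` would contradict primitivity.
    set i := τ t with hi
    obtain ⟨f, hf, hqf, hf1, hf2⟩ := exists_isIdempotentElem_mul_eq_zero_of_ker_isNilpotent
      q.toRingHom hnil' (Pi.single t 1) (hq _)
      (by rw [IsIdempotentElem, ← Pi.single_mul, mul_one]) (1 - e i)
      (he.complete.idem i).one_sub
      (by
        funext r
        rcases eq_or_ne r t with rfl | hr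
        · have : q (e i) r = 1 := hτ r
          simp [this]
        · simp [hr])
      (by
        funext r
        rcases eq_or_ne r t with rfl | hr
        · have : q (e i) r = 1 := hτ r
          simp [this]
        · simp [hr])
    have hqf : q f = Pi.single t 1 := hqf
    have h1 : f * e i = f := by rw [mul_sub, mul_one, sub_eq_zero] at hf1; exact hf1.symm
    have h2 : e i * f = f := by rw [sub_mul, one_mul, sub_eq_zero] at hf2; exact hf2.symm
    rcases (he.primitive i).indecomposable f (e i - f) hf
      (by rw [IsIdempotentElem, mul_sub, sub_mul, sub_mul, h1, h2, hf.eq,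
        (he.complete.idem i).eq, sub_self, sub_zero])
      (by rw [mul_sub, h1, hf.eq, sub_self]) (by rw [sub_mul, h2, hf.eq, sub_self])
      (by abel) with h | h
    · have := congrFun hqf t
      rw [h, map_zero] at this
      simp at this
    · have h3 : q (e i) s = q f s := by rw [sub_eq_zero.mp h]
      have h4 : q (e i) s = 1 := by rw [hts]; exact hτ s
      rw [h4, hqf, Pi.single_eq_of_ne (Ne.symm hne)] at h3
      exact one_ne_zero h3
  let σ : Fin m ≃ Fin n := Equiv.ofBijective τ ⟨hinj, hsurj⟩
  have hσ : ∀ i, τ (σ.symm i) = i := σ.apply_symm_apply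
  refine ⟨fun i => π (σ.symm i), fun i => ?_, fun i j hij => ?_, fun x hx => ?_⟩
  · have := hτ (σ.symm i)
    rwa [hσ] at this
  · exact hτ' _ _ (by rw [hσ]; exact hij.symm)
  · refine (hker x).mp (funext fun t => ?_)
    have : π (σ.symm (σ t)) x = 0 := hx (σ t)
    rwa [σ.symm_apply_apply] at this

theorem IsElementary.exists_isSplitBasic [Module.Finite k A] (hA : IsElementary k A) {n : ℕ}
    {e : Fin n → A} (he : IsCompletePrimitive e) :
    ∃ (χ : Fin n → A →ₐ[k] k) (χ' : Fin n → Aᵐᵒᵖ →ₐ[k] k), IsSplitBasic e χ ∧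
      IsSplitBasic (fun i => op (e i)) χ' := by
  obtain ⟨χ, h1, h2, h3⟩ := hA.exists_characters he
  have : IsArtinianRing A := isArtinian_of_tower k inferInstance
  have hnil : IsNilpotent (Ring.jacobson A) := IsSemiprimaryRing.isNilpotent
  let χ' : Fin n → Aᵐᵒᵖ →ₐ[k] k := fun i => oppositeCharacter (AlgEquiv.opOp k A) (χ i)
  have hχ' : ∀ i a, χ' i (op a) = χ i a := fun i a =>
    oppositeCharacter_apply (AlgEquiv.opOp k A) (χ i) a
  have hc : CompleteOrthogonalIdempotents fun i => op (e i) :=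
    { idem i := congrArg op (he.complete.idem i)
      ortho i j hij := congrArg op (he.complete.ortho hij.symm)
      complete := by
        rw [← Finset.op_sum, he.complete.complete, op_one] }
  have h1' : ∀ i, χ' i (op (e i)) = 1 := fun i => by rw [hχ', h1]
  have h2' : ∀ i j, i ≠ j → χ' i (op (e j)) = 0 := fun i j hij => by rw [hχ', h2 i j hij]
  refine ⟨χ, χ', ⟨he.complete, h1, h2, ?_⟩, ⟨hc, h1', h2', ?_⟩⟩
  · refine hasEigenvectors_of_annihilated he.complete h1 h2 fun M hM => ?_
    obtain ⟨v, hv, h⟩ := exists_annihilated_left hnil M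
    exact ⟨v, hv, fun x hx => h x (h3 x hx)⟩
  · refine hasEigenvectors_of_annihilated hc h1' h2' fun M hM => ?_
    obtain ⟨v, hv, h⟩ := exists_annihilated_right hnil M
    refine ⟨v, hv, fun x hx => ?_⟩
    induction x using MulOpposite.rec' with
    | _ x => exact h x (h3 x fun i => by rw [← hχ']; exact hx i)

end Elementary

/-! ### Duality between `Tor` and `Ext` -/

section ExtResolution

open Abelian CochainComplex.HomComplex

variable {C : Type*} [Category* C] [Abelian C] {X Y : C}

theorem extMk_zero_eq_zero_iff [HasExt C] (P : ProjectiveResolution X) (f : P.complex.X 0 ⟶ Y)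
    (hf : P.complex.d 1 0 ≫ f = 0) : P.extMk f 1 rfl hf = 0 ↔ f = 0 := by
  refine ⟨fun h => ?_, fun h => by subst h; exact P.extMk_zero 1 rfl⟩
  rw [← P.extEquivCohomologyClass.apply_eq_iff_eq, P.extEquivCohomologyClass_extMk,
    P.extEquivCohomologyClass_zero, CohomologyClass.mk_eq_zero_iff,
    Cocycle.toSingleMk_mem_coboundaries_iff _ _ _ _ _ 1 (by simp)] at h
  obtain ⟨g, hg⟩ := h
  have hz : Limits.IsZero (P.cochainComplex.X 1) :=
    CochainComplex.isZero_of_isStrictlyLE _ 0 _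
  rw [hz.eq_of_src g 0, Limits.comp_zero] at hg
  rwa [eq_comm, Preadditive.IsIso.comp_left_eq_zero] at hg

/-- Stated with `next` so that degree zero, where the differential to `q` is zero, needs no separate
treatment later. -/
theorem extMk_eq_zero_iff_next [HasExt C] (P : ProjectiveResolution X) {n q : ℕ}
    (f : P.complex.X n ⟶ Y) (hf : P.complex.d (n + 1) n ≫ f = 0)
    (hq : (ComplexShape.down ℕ).next n = q) :
    P.extMk f (n + 1) rfl hf = 0 ↔ ∃ g : P.complex.X q ⟶ Y, P.complex.d n q ≫ g = f := by
  rcases n with - | n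
  · rw [extMk_zero_eq_zero_iff]
    have : P.complex.d 0 q = 0 := P.complex.shape _ _ (by simp)
    rw [this]
    constructor
    · rintro rfl
      exact ⟨0, by simp⟩
    · rintro ⟨g, rfl⟩
      simp
  · rw [ChainComplex.next_nat_succ] at hq
    subst hq
    exact P.extMk_eq_zero_iff f _ rfl hf n rfl

/-- Cocycles of the complex `Hom(P, Y)` map onto `Ext`. -/
def extMkLinear [HasExt C] {k : Type*} [Field k] [Linear k C] (P : ProjectiveResolution X) (Y : C)
    (n : ℕ) : LinearMap.ker (Linear.leftComp k Y (P.complex.d (n + 1) n)) →ₗ[k] Ext X Y n where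
  toFun f := P.extMk f.1 (n + 1) rfl f.2
  map_add' f g := (P.add_extMk f.1 g.1 (n + 1) rfl f.2 g.2).symm
  map_smul' c f := by
    have h := P.extMk_comp_mk₀ f.1 (n + 1) rfl f.2 (c • 𝟙 Y)
    rw [RingHom.id_apply, Ext.smul_eq_comp_mk₀, h]
    congr 1
    simp

theorem extMkLinear_surjective [HasExt C] {k : Type*} [Field k] [Linear k C]
    (P : ProjectiveResolution X) (Y : C) (n : ℕ) :
    Function.Surjective (extMkLinear (k := k) P Y n) := fun x => by
  obtain ⟨f, hf, rfl⟩ := P.extMk_surjective x (n + 1) rfl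
  exact ⟨⟨f, hf⟩, rfl⟩

end ExtResolution

/-! ### Duals of homology spaces -/

section HomologyDual

variable {k : Type v} [Field k]

theorem exists_comp_eq_of_ker_le {V W E : Type*} [AddCommGroup V] [Module k V] [AddCommGroup W]
    [Module k W] [AddCommGroup E] [Module k E] (g : V →ₗ[k] W) (φ : V →ₗ[k] E)
    (h : LinearMap.ker g ≤ LinearMap.ker φ) : ∃ ψ : W →ₗ[k] E, ψ ∘ₗ g = φ := by
  obtain ⟨ψ, hψ⟩ := LinearMap.exists_extend
    (((LinearMap.ker g).liftQ φ h) ∘ₗ g.quotKerEquivRange.symm.toLinearMap)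
  refine ⟨ψ, LinearMap.ext fun x => ?_⟩
  have := LinearMap.congr_fun hψ ⟨g x, ⟨x, rfl⟩⟩
  have h2 : g.quotKerEquivRange.symm ⟨g x, ⟨x, rfl⟩⟩ = Submodule.Quotient.mk x := by
    rw [LinearEquiv.symm_apply_eq]
    rfl
  simp only [LinearMap.comp_apply, Submodule.subtype_apply, LinearEquiv.coe_coe, h2] at this
  exact this

/-- Functionals on `V` that vanish on the image of `f` restrict to functionals on the homology. -/
def homologyFunctional (S : ShortComplex (ModuleCat.{u} k)) (E : Type*) [AddCommGroup E]
    [Module k E] : LinearMap.ker (LinearMap.lcomp k E S.f.hom) →ₗ[k]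
      ((LinearMap.ker S.g.hom ⧸ LinearMap.range S.moduleCatToCycles) →ₗ[k] E) where
  toFun φ := Submodule.liftQ _ (φ.1 ∘ₗ (LinearMap.ker S.g.hom).subtype) (by
    rintro _ ⟨x, rfl⟩
    exact LinearMap.congr_fun φ.2 x)
  map_add' φ ψ := by ext; rfl
  map_smul' c φ := by ext; rfl

theorem homologyFunctional_surjective (S : ShortComplex (ModuleCat.{u} k)) (E : Type*)
    [AddCommGroup E] [Module k E] : Function.Surjective (homologyFunctional S E) := fun θ => by
  obtain ⟨φ, hφ⟩ := LinearMap.exists_extend (θ ∘ₗ Submodule.mkQ _)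
  refine ⟨⟨φ, LinearMap.ext fun x => ?_⟩, ?_⟩
  · have hx : (LinearMap.range S.moduleCatToCycles).mkQ (S.moduleCatToCycles x) = 0 :=
      (Submodule.Quotient.mk_eq_zero _).mpr (LinearMap.mem_range_self _ x)
    exact (LinearMap.congr_fun hφ (S.moduleCatToCycles x)).trans
      ((congrArg θ hx).trans (map_zero θ))
  · ext x
    exact LinearMap.congr_fun hφ x

/-- With surjectivity, this presents the dual of the homology as cocycles modulo coboundaries of the
dual complex. -/
theorem homologyFunctional_eq_zero_iff (S : ShortComplex (ModuleCat.{u} k)) (E : Type*)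
    [AddCommGroup E] [Module k E] (φ : LinearMap.ker (LinearMap.lcomp k E S.f.hom)) :
    homologyFunctional S E φ = 0 ↔ ∃ ψ : S.X₃ →ₗ[k] E, ψ ∘ₗ S.g.hom = φ.1 := by
  constructor
  · intro h
    refine exists_comp_eq_of_ker_le _ _ fun x hx => ?_
    exact LinearMap.congr_fun h (Submodule.Quotient.mk ⟨x, hx⟩)
  · rintro ⟨ψ, hψ⟩
    ext x
    change φ.1 x.1 = 0
    rw [← hψ, LinearMap.comp_apply, x.2, map_zero]

/-- Two quotients of a vector space with the same kernel are isomorphic. -/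
theorem nonempty_equiv_of_ker_eq {Z V W : Type*} [AddCommGroup Z] [Module k Z] [AddCommGroup V]
    [Module k V] [AddCommGroup W] [Module k W] {α : Z →ₗ[k] V} {β : Z →ₗ[k] W}
    (hα : Function.Surjective α) (hβ : Function.Surjective β)
    (h : ∀ z, α z = 0 ↔ β z = 0) : Nonempty (V ≃ₗ[k] W) := by
  have hk : LinearMap.ker α = LinearMap.ker β := Submodule.ext h
  exact ⟨(α.quotKerEquivOfSurjective hα).symm.trans ((Submodule.quotEquivOfEq _ _ hk).trans
    (β.quotKerEquivOfSurjective hβ))⟩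

end HomologyDual

/-! ### The adjunction between tensor product and dual, on derived functors -/

section TorDual

open Abelian
open scoped ModuleCat

variable {k : Type v} [Field k] [Small.{u} k] {R : Type u} [Ring R] [Algebra k R]

/-- A morphism into a dual module as a family of functionals. -/
def toFunctionals {M : ModuleCat.{u} Rᵐᵒᵖ} {P : ModuleCat.{u} R}
    (f : P ⟶ dualModule (AlgEquiv.opOp k R) M) : P →ₗ[k] M →ₗ[k] Shrink.{u} k where
  toFun p := f.hom p
  map_add' p q := map_add f.hom p q
  map_smul' c p := (map_smul f.hom (algebraMap k R c) p).trans
    (algebraMap_smul R c (show DualSpace (AlgEquiv.opOp k R) M from f.hom p))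

theorem toFunctionals_smul {M : ModuleCat.{u} Rᵐᵒᵖ} {P : ModuleCat.{u} R}
    (f : P ⟶ dualModule (AlgEquiv.opOp k R) M) (r : R) (p : P) (m : M) :
    toFunctionals f (r • p) m = toFunctionals f p (op r • m) :=
  LinearMap.congr_fun (show toFunctionals f (r • p) = _ from map_smul f.hom r p) m

/-- The adjunction `Hom_R(P, M*) ≅ (M ⊗_R P)*`. -/
def tensorDualEquiv (M : ModuleCat.{u} Rᵐᵒᵖ) (P : ModuleCat.{u} R) :
    (P ⟶ dualModule (AlgEquiv.opOp k R) M) ≃ₗ[k]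
      ((tensorFunctor k R M).obj P →ₗ[k] Shrink.{u} k) where
  toFun f := Submodule.liftQ _ (TensorProduct.lift (toFunctionals f).flip) (by
    rw [balancedRel, Submodule.span_le]
    rintro _ ⟨m, r, x, rfl⟩
    simp [toFunctionals_smul])
  map_add' f g := by
    refine Submodule.linearMap_qext _ (TensorProduct.ext' fun m x => ?_)
    rfl
  map_smul' c f := by
    refine Submodule.linearMap_qext _ (TensorProduct.ext' fun m x => ?_)
    exact LinearMap.congr_fun (algebraMap_smul R c
      (show DualSpace (AlgEquiv.opOp k R) M from f.hom x)) m
  invFun g := ModuleCat.ofHom (Y := DualSpace (AlgEquiv.opOp k R) M)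
    { toFun p := (g ∘ₗ Submodule.mkQ _ ∘ₗ (TensorProduct.mk k M P).flip p : M →ₗ[k] Shrink.{u} k)
      map_add' p q := LinearMap.ext fun m => by
        change g (Submodule.Quotient.mk (m ⊗ₜ (p + q))) = _
        rw [TensorProduct.tmul_add]
        exact map_add g (Submodule.Quotient.mk (m ⊗ₜ p)) (Submodule.Quotient.mk (m ⊗ₜ q))
      map_smul' r p := LinearMap.ext fun m => by
        change g (Submodule.Quotient.mk (m ⊗ₜ (r • p))) =
          g (Submodule.Quotient.mk ((op r • m) ⊗ₜ p))
        refine congrArg g (Eq.symm ?_)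
        exact (Submodule.Quotient.eq _).mpr (Submodule.subset_span ⟨m, r, p, rfl⟩) }
  left_inv f := by
    ext p
    exact LinearMap.ext fun m => rfl
  right_inv g := by
    refine Submodule.linearMap_qext _ (TensorProduct.ext' fun m x => ?_)
    rfl

theorem tensorDualEquiv_comp (M : ModuleCat.{u} Rᵐᵒᵖ) {P Q : ModuleCat.{u} R} (d : P ⟶ Q)
    (f : Q ⟶ dualModule (AlgEquiv.opOp k R) M) :
    tensorDualEquiv M P (d ≫ f) =
      tensorDualEquiv M Q f ∘ₗ ((tensorFunctor k R M).map d).hom := by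
  refine Submodule.linearMap_qext _ (TensorProduct.ext' fun m x => ?_)
  rfl

/-- `Tor_l(M, N)* ≅ Extˡ(N, M*)`. -/
theorem nonempty_tor_dual_equiv (M : ModuleCat.{u} Rᵐᵒᵖ) (N : ModuleCat.{u} R) (n : ℕ) :
    Nonempty ((Tor k R M N n →ₗ[k] Shrink.{u} k) ≃ₗ[k]
      Ext.{u} N (dualModule (AlgEquiv.opOp k R) M) n) := by
  let P := ProjectiveResolution.of N
  let F := tensorFunctor k R M
  let K := (F.mapHomologicalComplex (ComplexShape.down ℕ)).obj P.complex
  obtain ⟨q, hq⟩ : ∃ q, (ComplexShape.down ℕ).next n = q := ⟨_, rfl⟩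
  let S := K.sc' (n + 1) n q
  let D := dualModule (AlgEquiv.opOp k R) M
  have iso : Tor k R M N n ≅ S.homology :=
    P.isoLeftDerivedObj F n ≪≫ K.homologyIsoSc' (n + 1) n q (ChainComplex.prev ℕ n) hq
  have e₁ : Tor k R M N n ≃ₗ[k]
      (LinearMap.ker S.g.hom ⧸ LinearMap.range S.moduleCatToCycles) :=
    (iso ≪≫ S.moduleCatHomologyIso).toLinearEquiv
  let ε (p : ℕ) : (P.complex.X p ⟶ D) ≃ₗ[k] (F.obj (P.complex.X p) →ₗ[k] Shrink.{u} k) :=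
    tensorDualEquiv M (P.complex.X p)
  have hmem : ∀ f : LinearMap.ker (Linear.leftComp k D (P.complex.d (n + 1) n)),
      ε n f.1 ∈ LinearMap.ker (LinearMap.lcomp k (Shrink.{u} k) S.f.hom) := fun f => by
    have h : P.complex.d (n + 1) n ≫ f.1 = 0 := f.2
    have h2 := tensorDualEquiv_comp M (P.complex.d (n + 1) n) f.1
    rw [h, map_zero] at h2
    exact h2.symm
  let Ψ : LinearMap.ker (Linear.leftComp k D (P.complex.d (n + 1) n)) →ₗ[k]
      ((LinearMap.ker S.g.hom ⧸ LinearMap.range S.moduleCatToCycles) →ₗ[k] Shrink.{u} k) :=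
    homologyFunctional S (Shrink.{u} k) ∘ₗ
      (((ε n).toLinearMap ∘ₗ Submodule.subtype _).codRestrict _ hmem)
  have hΨ : Function.Surjective Ψ := fun θ => by
    obtain ⟨φ, rfl⟩ := homologyFunctional_surjective S _ θ
    obtain ⟨f, hf⟩ := (ε n).surjective φ.1
    refine ⟨⟨f, ?_⟩, congrArg (homologyFunctional S _) (Subtype.ext hf)⟩
    apply (ε (n + 1)).injective
    refine (tensorDualEquiv_comp M (P.complex.d (n + 1) n) f).trans ?_
    rw [map_zero]
    change (ε n f) ∘ₗ _ = 0
    rw [hf]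
    exact φ.2
  -- The dual of Tor and Ext are both quotients of the cocycles in `Hom(P, D)`; the adjunction
  -- matches the coboundaries.
  obtain ⟨e₂⟩ := nonempty_equiv_of_ker_eq (α := Ψ) (β := extMkLinear P D n) hΨ
    (extMkLinear_surjective P D n) (fun f => by
      refine (homologyFunctional_eq_zero_iff S _ _).trans
        (Iff.trans ?_ (extMk_eq_zero_iff_next P f.1 f.2 hq).symm)
      constructor
      · rintro ⟨ψ, hψ⟩
        obtain ⟨g, rfl⟩ := (ε q).surjective ψ
        refine ⟨g, (ε n).injective ?_⟩
        exact (tensorDualEquiv_comp M (P.complex.d n q) g).trans hψ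
      · rintro ⟨g, hg⟩
        refine ⟨ε q g, ?_⟩
        refine (tensorDualEquiv_comp M (P.complex.d n q) g).symm.trans ?_
        rw [hg]
        rfl)
  exact ⟨(LinearEquiv.congrLeft (Shrink.{u} k) k e₁).trans e₂⟩

theorem IsEulerChar.tor_of_ext (M : ModuleCat.{u} Rᵐᵒᵖ) (N : ModuleCat.{u} R) {x : ℤ}
    (h : IsEulerChar k (fun l => Ext.{u} N (dualModule (AlgEquiv.opOp k R) M) l) x) :
    IsEulerChar k (fun l => Tor k R M N l) x := by
  refine h.congr fun l hl => ?_
  obtain ⟨e⟩ := nonempty_tor_dual_equiv (k := k) M N l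
  let e' : Module.Dual k (Tor k R M N l) ≃ₗ[k] Ext.{u} N (dualModule (AlgEquiv.opOp k R) M) l :=
    (LinearEquiv.congrRight (Shrink.linearEquiv.{u} k k)).symm.trans e
  have h1 : Module.Finite k (Module.Dual k (Tor k R M N l)) := Module.Finite.equiv e'.symm
  have h2 : Module.Finite k (Tor k R M N l) := Module.finite_dual_iff k |>.mp h1
  exact ⟨h2, by rw [← e'.finrank_eq, Subspace.dual_finrank_eq]⟩

end TorDual

/-! ### Cartan matrices of opposite algebras and tensor products -/

section Cartan

open scoped ModuleCat Kronecker

variable {k : Type v} [Field k]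

theorem finrank_range_eq_of_equiv {V W V' W' : Type*} [AddCommGroup V] [Module k V]
    [AddCommGroup W] [Module k W] [AddCommGroup V'] [Module k V'] [AddCommGroup W'] [Module k W']
    (e : V ≃ₗ[k] W) (e' : V' ≃ₗ[k] W') {f : V →ₗ[k] V'} {g : W →ₗ[k] W'}
    (h : ∀ x, e' (f x) = g (e x)) :
    Module.finrank k (LinearMap.range f) = Module.finrank k (LinearMap.range g) := by
  have key : (LinearMap.range f).map e'.toLinearMap = LinearMap.range g := by
    ext y
    constructor
    · rintro ⟨_, ⟨x, rfl⟩, rfl⟩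
      exact ⟨e x, (h x).symm⟩
    · rintro ⟨x, rfl⟩
      exact ⟨_, ⟨e.symm x, rfl⟩, (h _).trans (by rw [e.apply_symm_apply])⟩
  rw [← key]
  exact (e'.submoduleMap _).finrank_eq

/-- The map factors as a surjection onto the tensor product of the two ranges, followed by an
injection by flatness. -/
theorem finrank_range_tensor_map {V W V' W' : Type*} [AddCommGroup V] [Module k V]
    [AddCommGroup W] [Module k W] [AddCommGroup V'] [Module k V'] [AddCommGroup W'] [Module k W']
    (f : V →ₗ[k] V') (g : W →ₗ[k] W') :
    Module.finrank k (LinearMap.range (TensorProduct.map f g)) =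
      Module.finrank k (LinearMap.range f) * Module.finrank k (LinearMap.range g) := by
  rw [← Module.finrank_tensorProduct]
  let i := TensorProduct.map (LinearMap.range f).subtype (LinearMap.range g).subtype
  let s := TensorProduct.map f.rangeRestrict g.rangeRestrict
  have hi : Function.Injective i :=
    Module.Flat.tensorProduct_mapIncl_injective_of_right _ _
  have hs : Function.Surjective s :=
    TensorProduct.map_surjective f.surjective_rangeRestrict g.surjective_rangeRestrict
  have his : TensorProduct.map f g = i ∘ₗ s := by
    rw [← TensorProduct.map_comp]
    rfl
  rw [his, LinearMap.range_comp_of_range_eq_top _ (LinearMap.range_eq_top.mpr hs),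
    LinearMap.finrank_range_of_inj hi]

variable {A R B C : Type u} [Ring A] [Algebra k A] [Ring B] [Algebra k B] [Ring C] [Algebra k C]
  [Ring R] [Algebra k R] {ι κ : Type}

theorem cartan_map (e : ι → R) (g : R ≃ₐ[k] B) : cartan k (fun i => g (e i)) = cartan k e := by
  ext i j
  refine congrArg Nat.cast (Eq.symm ?_)
  exact finrank_range_eq_of_equiv g.toLinearEquiv g.toLinearEquiv fun x => by simp

theorem cartan_tensor (e : ι → B) (e' : κ → C) :
    cartan k (fun p : ι × κ => e p.1 ⊗ₜ[k] e' p.2) = cartan k e ⊗ₖ cartan k e' := by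
  ext p q
  have h : LinearMap.mulLeft k (e q.1 ⊗ₜ[k] e' q.2) ∘ₗ LinearMap.mulRight k (e p.1 ⊗ₜ[k] e' p.2) =
      TensorProduct.map (LinearMap.mulLeft k (e q.1) ∘ₗ LinearMap.mulRight k (e p.1))
        (LinearMap.mulLeft k (e' q.2) ∘ₗ LinearMap.mulRight k (e' p.2)) :=
    TensorProduct.ext' fun x y => by simp
  simp only [cartan, Matrix.of_apply, Matrix.kroneckerMap_apply]
  rw [h, finrank_range_tensor_map]
  push_cast
  rfl

theorem cartan_op (e : ι → R) : cartan k (fun i => op (e i)) = (cartan k e).transpose := by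
  ext i j
  refine congrArg Nat.cast (Eq.symm ?_)
  refine finrank_range_eq_of_equiv (opLinearEquiv k) (opLinearEquiv k) fun x => ?_
  simp [mul_assoc]

theorem cartanMatrix_eq_cartan {n : ℕ} (e : Fin n → A) : cartanMatrix k e = cartan k e := by
  ext i j
  rfl

end Cartan

/-! ### Dimension vectors of modules and bimodules -/

section Dimensions

open scoped ModuleCat

variable {k : Type v} [Field k] {A R : Type u} [Ring A] [Algebra k A] [Ring R] [Algebra k R]

theorem dimAt_of (M : Type u) [AddCommGroup M] [i : Module k M] [Module R M]
    [IsScalarTower k R M] (a : R) :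
    dimAt k a (ModuleCat.of R M) =
      Module.finrank k (LinearMap.range (Algebra.lsmul k k M a)) := by
  have e := module_eq_restrictScalars (k := k) (R := R) (i := i)
  subst e
  rfl

variable (M : Type u) [AddCommGroup M] [Module k M] [Module A M] [Module Aᵐᵒᵖ M]
  [IsScalarTower k A M] [IsScalarTower k Aᵐᵒᵖ M] [SMulCommClass A Aᵐᵒᵖ M]

variable (k A) in
/-- A bimodule and the associated left module have the same underlying vector space. -/
def leftEnvEquiv : leftEnv k A M ≃ₗ[k] M where
  toFun x := x
  invFun x := x
  map_add' _ _ := rfl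
  map_smul' c x := by
    change (algebraMap k (Env k A) c • x : leftEnv k A M) = (c • (show M from x) : M)
    have h : algebraMap k (Env k A) c = op (algebraMap k A c) ⊗ₜ[k] 1 := rfl
    rw [h]
    refine (leftEnv_smul k A M (algebraMap k A c) 1 x).trans ?_
    change (1 : A) • (algebraMap k Aᵐᵒᵖ c) • (show M from x) = _
    rw [one_smul, algebraMap_smul]

variable (k A) in
/-- A bimodule and the associated right module have the same underlying vector space. -/
def rightEnvEquiv : rightEnv k A M ≃ₗ[k] M where
  toFun x := x
  invFun x := x
  map_add' _ _ := rfl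
  map_smul' c x := by
    change (algebraMap k (Env k A)ᵐᵒᵖ c • x : rightEnv k A M) = (c • (show M from x) : M)
    have h : algebraMap k (Env k A)ᵐᵒᵖ c = op (op (algebraMap k A c) ⊗ₜ[k] 1) := rfl
    rw [h]
    refine (rightEnv_smul k A M (algebraMap k A c) 1 x).trans ?_
    change (algebraMap k A c) • (1 : Aᵐᵒᵖ) • (show M from x) = _
    rw [one_smul, algebraMap_smul]

instance finite_leftEnv [Module.Finite k M] : Module.Finite k (leftEnv k A M) :=
  Module.Finite.equiv (leftEnvEquiv k A M).symm

instance finite_rightEnv [Module.Finite k M] : Module.Finite k (rightEnv k A M) :=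
  Module.Finite.equiv (rightEnvEquiv k A M).symm

variable {n : ℕ} (e : Fin n → A)

theorem dimAt_leftEnv (i j : Fin n) :
    (dimAt k (op (e i) ⊗ₜ[k] e j) (leftEnv k A M) : ℤ) = dimMatrix k e M i j :=
  congrArg Nat.cast (finrank_range_eq_of_equiv (leftEnvEquiv k A M) (leftEnvEquiv k A M)
    fun x => leftEnv_smul k A M (e i) (e j) x)

/-- On the right module `op a ⊗ b` acts by `m ↦ a m b`, on the left one by `m ↦ b m a`; hence the
swapped indices. -/
theorem dimAt_rightEnv (i j : Fin n) :
    (dimAt k (op (op (e i) ⊗ₜ[k] e j)) (rightEnv k A M) : ℤ) = dimMatrix k e M j i :=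
  congrArg Nat.cast (finrank_range_eq_of_equiv (rightEnvEquiv k A M) (rightEnvEquiv k A M)
    fun x => rightEnv_smul k A M (e i) (e j) x)

end Dimensions

/-! ### Matrix identities -/

section Matrices

open scoped Kronecker

variable {ι : Type} [Fintype ι] [DecidableEq ι]

theorem isUnit_det_kronecker {C D : Matrix ι ι ℤ} (hC : IsUnit C.det) (hD : IsUnit D.det) :
    IsUnit (C ⊗ₖ D).det := by
  rw [Matrix.det_kronecker]
  exact (hC.pow _).mul (hD.pow _)

/-- The identity `C = C C⁻¹ C` says that `C`, unfolded to a row vector, is the unfolded `C⁻¹` times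
the Kronecker product, which then cancels. -/
theorem dotProduct_inv_kronecker_transpose {C : Matrix ι ι ℤ} (hC : IsUnit C.det)
    (M : Matrix ι ι ℤ) :
    (fun p : ι × ι => C p.2 p.1) ⬝ᵥ Matrix.mulVec (C ⊗ₖ C.transpose)⁻¹ (fun p => M p.2 p.1) =
      Matrix.trace (C⁻¹.transpose * M) := by
  have hD : IsUnit (C ⊗ₖ C.transpose).det :=
    isUnit_det_kronecker hC (by rwa [Matrix.det_transpose])
  have hw : (fun p : ι × ι => C p.2 p.1) =
      Matrix.vecMul (fun p : ι × ι => C⁻¹ p.2 p.1) (C ⊗ₖ C.transpose) := funext fun p => by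
    have h : C p.2 p.1 = (C * (C⁻¹ * C)) p.2 p.1 := by
      rw [Matrix.nonsing_inv_mul _ hC, Matrix.mul_one]
    rw [h, Matrix.mul_apply, Matrix.vecMul, dotProduct, Fintype.sum_prod_type, Finset.sum_comm]
    refine Finset.sum_congr rfl fun j _ => ?_
    rw [Matrix.mul_apply, Finset.mul_sum]
    refine Finset.sum_congr rfl fun i _ => ?_
    simp only [Matrix.kroneckerMap_apply, Matrix.transpose_apply]
    ring
  rw [hw, Matrix.dotProduct_mulVec, Matrix.vecMul_vecMul, Matrix.mul_nonsing_inv _ hD,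
    Matrix.vecMul_one, dotProduct, Fintype.sum_prod_type, Matrix.trace]
  rfl

theorem dotProduct_inv_transpose_kronecker {C : Matrix ι ι ℤ} (hC : IsUnit C.det)
    (M : Matrix ι ι ℤ) :
    (fun p : ι × ι => M p.1 p.2) ⬝ᵥ Matrix.mulVec (C.transpose ⊗ₖ C)⁻¹ (fun p => C p.2 p.1) =
      Matrix.trace (C⁻¹ * M) := by
  have hD : IsUnit (C.transpose ⊗ₖ C).det :=
    isUnit_det_kronecker (by rwa [Matrix.det_transpose]) hC
  have hw : (fun p : ι × ι => C p.2 p.1) =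
      Matrix.mulVec (C.transpose ⊗ₖ C) (fun p : ι × ι => C⁻¹ p.2 p.1) := funext fun p => by
    have h : C p.2 p.1 = (C * (C⁻¹ * C)) p.2 p.1 := by
      rw [Matrix.nonsing_inv_mul _ hC, Matrix.mul_one]
    rw [h, Matrix.mul_apply, Matrix.mulVec, dotProduct, Fintype.sum_prod_type, Finset.sum_comm]
    refine Finset.sum_congr rfl fun j _ => ?_
    rw [Matrix.mul_apply, Finset.mul_sum]
    refine Finset.sum_congr rfl fun i _ => ?_
    simp only [Matrix.kroneckerMap_apply, Matrix.transpose_apply]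
    ring
  rw [hw, Matrix.mulVec_mulVec, Matrix.nonsing_inv_mul _ hD, Matrix.one_mulVec, dotProduct,
    Fintype.sum_prod_type, Matrix.trace_mul_comm, Matrix.trace]
  rfl

end Matrices

/-! ### The four formulas -/

section Main

open Abelian
open scoped ModuleCat

variable {k : Type v} [Field k] {A : Type u} [Ring A] [Algebra k A]

theorem HasFiniteGlobalDimension.hasFiniteModGldim (hgl : HasFiniteGlobalDimension A) :
    HasFiniteModGldim k Aᵐᵒᵖ := by
  obtain ⟨d, hd⟩ := hgl
  exact ⟨d + 1, fun M _ => hd M⟩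

/-- The formulas over the zero algebra, where all modules vanish. -/
theorem formulas_of_subsingleton [Subsingleton A] {n : ℕ} [IsEmpty (Fin n)] (e : Fin n → A) :
    CohomologicalHRR k e ∧ HomologicalHRR k e ∧ HochschildCohomologicalHRR k e ∧
      HochschildHomologicalHRR k e := by
  have hA : ∀ {S : Type u} [Ring S] [Subsingleton S] (X : ModuleCat.{u} S), Limits.IsZero X :=
    fun {S} _ _ X => by
      have := Module.subsingleton S X
      exact ModuleCat.isZero_of_subsingleton X
  have hExt : ∀ {S : Type u} [Ring S] [Algebra k S] [Subsingleton S] (X Y : ModuleCat.{u} S)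
      {x : ℤ}, x = 0 → IsEulerChar k (fun l => Ext.{u} X Y l) x := fun X Y x hx => by
    have := (hA X).hasProjectiveDimensionLT_zero
    rw [hx]
    exact IsEulerChar.of_subsingleton fun l =>
      HasProjectiveDimensionLT.subsingleton X 0 l (Nat.zero_le l) Y
  have hTor : ∀ {S : Type u} [Ring S] [Algebra k S] [Subsingleton S] (X : ModuleCat.{u} Sᵐᵒᵖ)
      (Y : ModuleCat.{u} S) {x : ℤ}, x = 0 → IsEulerChar k (fun l => Tor k S X Y l) x :=
    fun {S} _ _ _ X Y x hx => by
      rw [hx]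
      refine IsEulerChar.of_subsingleton fun l => ModuleCat.subsingleton_of_isZero
        (Limits.IsZero.of_iso ?_
          ((ProjectiveResolution.of Y).isoLeftDerivedObj (tensorFunctor k S X) l))
      erw [← HomologicalComplex.exactAt_iff_isZero_homology]
      exact ShortComplex.exact_of_isZero_X₂ _ ((tensorFunctor k S X).map_isZero (hA _))
  have : Subsingleton (Env k A) := inferInstanceAs (Subsingleton (Aᵐᵒᵖ ⊗[k] A))
  refine ⟨?_, ?_, ?_, ?_⟩
  · intro M N _ _ _ _ _ _ _ _ _ _
    exact hExt _ _ (by simp [ringelForm, dotProduct])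
  · intro M N _ _ _ _ _ _ _ _ _ _
    exact hTor _ _ (by simp [dotProduct])
  · intro M _ _ _ _ _ _ _ _
    exact hExt _ _ (by simp [Matrix.trace])
  · intro M _ _ _ _ _ _ _ _
    exact hTor _ _ (by simp [Matrix.trace])

variable [Module.Finite k A] {n : ℕ} {e : Fin n → A}

variable {χ : Fin n → A →ₐ[k] k} {χ' : Fin n → Aᵐᵒᵖ →ₐ[k] k}

/-- Right modules are left modules over `Aᵐᵒᵖ`, whose Cartan matrix is the transpose. -/
theorem cohomologicalHRR (h' : IsSplitBasic (fun i => op (e i)) χ')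
    (hd : HasFiniteModGldim k Aᵐᵒᵖ) : CohomologicalHRR k e := by
  intro M N _ _ _ _ _ _ _ _ _ _
  have := finite_moduleCat_of (k := k) (R := Aᵐᵒᵖ) M
  have := finite_moduleCat_of (k := k) (R := Aᵐᵒᵖ) N
  have key := h'.isEulerChar_ext hd (ModuleCat.of Aᵐᵒᵖ M) (ModuleCat.of Aᵐᵒᵖ N)
  have hM : dimVec k (fun i => op (e i)) (ModuleCat.of Aᵐᵒᵖ M) = dimVecRight k e M :=
    funext fun i => congrArg Nat.cast (dimAt_of M (op (e i)))
  have hN : dimVec k (fun i => op (e i)) (ModuleCat.of Aᵐᵒᵖ N) = dimVecRight k e N :=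
    funext fun i => congrArg Nat.cast (dimAt_of N (op (e i)))
  rwa [cartan_op, hM, hN, ← Matrix.transpose_nonsing_inv, ← cartanMatrix_eq_cartan] at key

theorem homologicalHRR [Small.{u} k] (h : IsSplitBasic e χ) (hd : HasFiniteModGldim k A) :
    HomologicalHRR k e := by
  intro M N _ _ _ _ _ _ _ _ _ _
  have := finite_moduleCat_of (k := k) (R := Aᵐᵒᵖ) M
  have := finite_moduleCat_of (k := k) (R := A) N
  refine IsEulerChar.tor_of_ext _ _ ?_
  have key := h.isEulerChar_ext hd (ModuleCat.of A N)
    (dualModule (AlgEquiv.opOp k A) (ModuleCat.of Aᵐᵒᵖ M))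
  have hM : dimVec k e (dualModule (AlgEquiv.opOp k A) (ModuleCat.of Aᵐᵒᵖ M)) =
      dimVecRight k e M :=
    funext fun i => congrArg Nat.cast ((dimAt_dualModule _ _ _).trans (dimAt_of M (op (e i))))
  have hN : dimVec k e (ModuleCat.of A N) = dimVecLeft k e N :=
    funext fun i => congrArg Nat.cast (dimAt_of N (e i))
  rwa [hM, hN, ← cartanMatrix_eq_cartan] at key

theorem hochschildCohomologicalHRR [Small.{u} k] (h : IsSplitBasic e χ)
    (h' : IsSplitBasic (fun i => op (e i)) χ') (hd : HasFiniteModGldim k A)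
    (hd' : HasFiniteModGldim k Aᵐᵒᵖ) : HochschildCohomologicalHRR k e := by
  intro M _ _ _ _ _ _ _ _
  have hs := (h.tensor h').map (envOp k A).symm
  have hg : HasFiniteModGldim k (Env k A) := hd'.tensor h'.eigen h.eigen hd
  have hg' : HasFiniteModGldim k (Env k A)ᵐᵒᵖ := HasFiniteModGldim.opposite AlgEquiv.refl hg hs.eigen
  have key := hs.isEulerChar_ext hg' (rightEnv k A A) (rightEnv k A M)
  have he : ∀ p : Fin n × Fin n, (envOp k A).symm (e p.1 ⊗ₜ[k] op (e p.2)) =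
      op (op (e p.1) ⊗ₜ[k] e p.2) := fun p => rfl
  have hN : ∀ (N : Type u) [AddCommGroup N] [Module k N] [Module A N] [Module Aᵐᵒᵖ N]
      [IsScalarTower k A N] [IsScalarTower k Aᵐᵒᵖ N] [SMulCommClass A Aᵐᵒᵖ N],
      dimVec k (fun p : Fin n × Fin n => (envOp k A).symm (e p.1 ⊗ₜ[k] op (e p.2)))
        (rightEnv k A N) = fun p => dimMatrix k e N p.2 p.1 := fun N _ _ _ _ _ _ _ =>
    funext fun p => by
      rw [dimVec, he]
      exact dimAt_rightEnv N e p.1 p.2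
  rw [hN A, hN M, cartan_map, cartan_tensor e fun i => op (e i), cartan_op, ← cartanMatrix_eq_cartan] at key
  have hC := h.isUnit_det_cartan hd
  rw [← cartanMatrix_eq_cartan] at hC
  rw [← dotProduct_inv_kronecker_transpose hC]
  exact key

/-- By duality the dimensions are those of `Extˡ(M, A*)` over the enveloping algebra, and `A*` has
the dimension vector of `A`. -/
theorem hochschildHomologicalHRR [Small.{u} k] (h : IsSplitBasic e χ)
    (h' : IsSplitBasic (fun i => op (e i)) χ') (hd : HasFiniteModGldim k A)
    (hd' : HasFiniteModGldim k Aᵐᵒᵖ) : HochschildHomologicalHRR k e := by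
  intro M _ _ _ _ _ _ _ _
  have hs := h'.tensor h
  have hg : HasFiniteModGldim k (Env k A) := hd'.tensor h'.eigen h.eigen hd
  refine IsEulerChar.tor_of_ext _ _ ?_
  have key := hs.isEulerChar_ext hg (leftEnv k A M)
    (dualModule (AlgEquiv.opOp k (Env k A)) (rightEnv k A A))
  have h1 : dimVec k (fun p : Fin n × Fin n => op (e p.1) ⊗ₜ[k] e p.2) (leftEnv k A M) =
      fun p => dimMatrix k e M p.1 p.2 := funext fun p => dimAt_leftEnv M e p.1 p.2
  have h2 : dimVec k (fun p : Fin n × Fin n => op (e p.1) ⊗ₜ[k] e p.2)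
      (dualModule (AlgEquiv.opOp k (Env k A)) (rightEnv k A A)) =
      fun p => dimMatrix k e A p.2 p.1 := funext fun p => by
    rw [dimVec, dimAt_dualModule]
    exact dimAt_rightEnv A e p.1 p.2
  rw [h1, h2, cartan_tensor (fun i => op (e i)) e, cartan_op, ← cartanMatrix_eq_cartan] at key
  have hC := h.isUnit_det_cartan hd
  rw [← cartanMatrix_eq_cartan] at hC
  rw [← dotProduct_inv_transpose_kronecker hC]
  exact key

end Main

end HRR

end

open HRR in
theorem theorem1 {k : Type v} {A : Type u} [Field k] [Ring A] [Algebra k A]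
    [Module.Finite k A] (hA : IsElementary k A) (hgl : HasFiniteGlobalDimension A)
    {n : ℕ} (e : Fin n → A) (he : IsCompletePrimitive e) :
    IsUnit (cartanMatrix k e).det ∧
    List.TFAE [CohomologicalHRR k e, HomologicalHRR k e,
      HochschildCohomologicalHRR k e, HochschildHomologicalHRR k e] ∧
    CohomologicalHRR k e ∧
    HomologicalHRR k e ∧
    HochschildCohomologicalHRR k e ∧
    HochschildHomologicalHRR k e := by
  suffices H : IsUnit (cartanMatrix k e).det ∧ CohomologicalHRR k e ∧ HomologicalHRR k e ∧
      HochschildCohomologicalHRR k e ∧ HochschildHomologicalHRR k e by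
    obtain ⟨hdet, h1, h2, h3, h4⟩ := H
    refine ⟨hdet, ?_, h1, h2, h3, h4⟩
    tfae_have 1 → 2 := fun _ => h2
    tfae_have 2 → 3 := fun _ => h3
    tfae_have 3 → 4 := fun _ => h4
    tfae_have 4 → 1 := fun _ => h1
    tfae_finish
  rcases subsingleton_or_nontrivial A with hs | hn
  · have : IsEmpty (Fin n) := ⟨fun i => (he.primitive i).ne_zero (Subsingleton.elim _ _)⟩
    exact ⟨by rw [Matrix.det_isEmpty]; exact isUnit_one, formulas_of_subsingleton e⟩
  -- A nonzero algebra contains `k`, so `k` has a copy in the universe of `A` and dual modules stay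
  -- there; the zero algebra gives no such embedding and is handled apart.
  · have : Small.{u} k := small_of_injective (algebraMap k A).injective
    obtain ⟨χ, χ', h, h'⟩ := hA.exists_isSplitBasic he
    have hd' : HasFiniteModGldim k Aᵐᵒᵖ := hgl.hasFiniteModGldim
    have hd : HasFiniteModGldim k A := HasFiniteModGldim.opposite (AlgEquiv.opOp k A) hd' h.eigen
    exact ⟨cartanMatrix_eq_cartan (k := k) e ▸ h.isUnit_det_cartan hd, cohomologicalHRR h' hd',
      homologicalHRR h hd, hochschildCohomologicalHRR h h' hd hd',
      hochschildHomologicalHRR h h' hd hd'⟩
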